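/- Theorem 1.2. For a group $G$ let $[G,G]$ be its commutator subgroup and $Z(G)$ its center, and let $\circ_G\colon G/Z(G)\times G/Z(G)\to [G,G]$, $(xZ(G),yZ(G))\mapsto [x,y]$, be its commutation map. Groups $G$ and $H$ are isoclinic if there are isomorphisms $f\colon G/Z(G)\to H/Z(H)$ and $\hat f\colon [G,G]\to[H,H]$ with $f(u)\circ_H f(v)=\hat f(u\circ_G v)$ for all $u,v\in G/Z(G)$. A central decomposition of $G$ is a set $\mathcal H$ of subgroups generating $G$ such that, for every $H\in\mathcal H$, one has $G\neq\langle \mathcal H\setminus\{H\}\rangle$ and $[H,\langle\mathcal H\setminus\{H\}\rangle]=1$; and $G$ is centrally indecomposable if $\{G\}$ is its only central decomposition. A centrally indecomposable group $G$ is here said to have genus $2$ over a field $k$ if $G/Z(G)$ and $[G,G]$ carry structures of finite-dimensional $k$-vector spaces, extending their group structures, such that $\dim_k [G,G]=2$ and $\circ_G$ is $k$-bilinear. (If $k$ is the largest ring over which $\circ_G$ is bilinear, the centroid of $\circ_G$, this says that $[G,G]$ has rank $2$ over the centroid; it is not required that $k$ be the whole centroid.) Let $p$ be a prime, $k$ a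 field, and $G$ a centrally indecomposable $p$-group of genus $2$ over $k$. Then $G$ is isoclinic to one of the following groups. (i) (Sloped case) A quotient $H/L$ of a Heisenberg group $$H=\left\{\begin{bmatrix}1&e&w\\0&1&f\\0&0&1\end{bmatrix} : e,f,w\in R\right\},\qquad R=k[x]/(a(x)^c),$$ with $a(x)\in k[x]$ irreducible and $c\geq 1$, by a subgroup $L\leq [H,H]$ consisting of the matrices with $e=f=0$ and $w\in L_0$, where $L_0$ is a $k$-subspace of codimension $2$ in $R\cong k^{n}$, $n=c\deg a(x)$. (ii) (Flat case) For some $m\geq 1$, the matrix group $$H^{\flat}=\left\{\left[\begin{array}{c|c|c} I_2 & \begin{array}{cccc} e_1&\cdots&e_m&0\\ 0&e_1&\cdots&e_m\end{array} & \begin{array}{c} w_1\\w_2\end{array}\\ \hline & I_{m+1} & \begin{array}{c} f_0\\ \vdots\\ f_m\end{array}\\ \hline & & 1\end{array}\right] : e_i,f_j,w_\ell\in k\right\}.$$ -/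

import Mathlib

open Polynomial
open scoped commutatorElement

/-! ### Commutation and isoclinism -/

theorem commutator_mul_central {G : Type*} [Group G] {z t : G} (hz : z ∈ Subgroup.center G)
    (ht : t ∈ Subgroup.center G) (a b : G) : ⁅a * z, b * t⁆ = ⁅a, b⁆ := by
  rw [Subgroup.mem_center_iff] at hz ht
  have h1 : ∀ g, z * g * z⁻¹ = g := fun g => by rw [← hz g]; group
  have h2 : ∀ g, t * g * t⁻¹ = g := fun g => by rw [← ht g]; group
  calc ⁅a * z, b * t⁆ = a * (z * (b * t) * z⁻¹) * a⁻¹ * t⁻¹ * b⁻¹ := by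
        rw [commutatorElement_def]; group
    _ = a * b * (t * a⁻¹ * t⁻¹) * b⁻¹ := by rw [h1]; group
    _ = ⁅a, b⁆ := by rw [h2, commutatorElement_def]

/-- The commutation map `G/Z(G) × G/Z(G) → [G, G]`, sending `(x Z(G), y Z(G))` to `[x, y]`. -/
def commutation (G : Type*) [Group G] (x y : G ⧸ Subgroup.center G) : commutator G :=
  Quotient.liftOn₂' x y
    (fun a b => ⟨⁅a, b⁆, by
      rw [commutator_def]
      exact Subgroup.commutator_mem_commutator (Subgroup.mem_top a) (Subgroup.mem_top b)⟩)
    (by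
      intro a b a' b' ha hb
      rw [QuotientGroup.leftRel_apply] at ha hb
      apply Subtype.ext
      have h := commutator_mul_central ha hb a b
      rw [mul_inv_cancel_left, mul_inv_cancel_left] at h
      exact h.symm)

/-- Two groups are isoclinic: there are isomorphisms `G/Z(G) ≅ H/Z(H)` and `[G, G] ≅ [H, H]`
that carry the commutation map of `G` to that of `H`. -/
def Isoclinic (G H : Type*) [Group G] [Group H] : Prop :=
  ∃ (f : (G ⧸ Subgroup.center G) ≃* (H ⧸ Subgroup.center H)) (f' : commutator G ≃* commutator H),
    ∀ x y : G ⧸ Subgroup.center G, commutation H (f x) (f y) = f' (commutation G x y)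

/-! ### Central decompositions -/

/-- A central decomposition of `G`: a set of subgroups that generates `G`, such that for each
member `H` the remaining members do not generate `G`, and commute with `H`. -/
def IsCentralDecomposition {G : Type*} [Group G] (S : Set (Subgroup G)) : Prop :=
  sSup S = ⊤ ∧ ∀ H ∈ S, sSup (S \ {H}) ≠ ⊤ ∧ ⁅H, sSup (S \ {H})⁆ = ⊥

/-- `G` is centrally indecomposable: `{G}` is its one and only central decomposition. -/
def IsCentrallyIndecomposable (G : Type*) [Group G] : Prop :=
  ∀ S : Set (Subgroup G), IsCentralDecomposition S ↔ S = {⊤}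

/-! ### Genus 2 over a field -/

/-- The commutator structure of `G` is encoded over the field `k`, with commutator subgroup of
dimension `2`: the groups `G/Z(G)` and `[G, G]` carry `k`-vector space structures, given here by
additive coordinate isomorphisms with `k ^ d` and `k ^ 2`, for which commutation is a `k`-bilinear
map `k ^ d × k ^ d → k ^ 2`. Then `G` is nilpotent of class `2`.
If the field `k` is the centroid of the commutation map (the largest ring over which it is
bilinear), this says that `[G, G]` has rank `2` over the centroid. That `k` be the whole
centroid is not required. -/
def HasGenusTwoOver (k : Type*) [Field k] (G : Type*) [Group G] : Prop :=
  ∃ (d : ℕ) (eV : Additive (G ⧸ Subgroup.center G) ≃+ (Fin d → k))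
    (eW : Additive (commutator G) ≃+ (Fin 2 → k))
    (B : (Fin d → k) →ₗ[k] (Fin d → k) →ₗ[k] (Fin 2 → k)),
    ∀ x y : G ⧸ Subgroup.center G,
      eW (Additive.ofMul (commutation G x y)) =
        B (eV (Additive.ofMul x)) (eV (Additive.ofMul y))

/-! ### Heisenberg groups and their central quotients -/

/-- The matrix with rows `(1, e, w)`, `(0, 1, f)`, `(0, 0, 1)`. -/
def heisenbergMatrix {R : Type*} [CommRing R] (e f w : R) : Matrix (Fin 3) (Fin 3) R :=
  !![1, e, w; 0, 1, f; 0, 0, 1]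

theorem heisenbergMatrix_mul {R : Type*} [CommRing R] (e f w e' f' w' : R) :
    heisenbergMatrix e f w * heisenbergMatrix e' f' w' =
      heisenbergMatrix (e + e') (f + f') (w + w' + e * f') := by
  ext i j
  fin_cases i <;> fin_cases j <;>
    simp [heisenbergMatrix, Matrix.mul_apply, Fin.sum_univ_three] <;> ring

theorem heisenbergMatrix_zero {R : Type*} [CommRing R] :
    heisenbergMatrix (0 : R) 0 0 = 1 := by
  ext i j
  fin_cases i <;> fin_cases j <;> simp [heisenbergMatrix]

/-- The Heisenberg group over a commutative ring `R`, as a group of matrices. -/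
def heisenberg (R : Type*) [CommRing R] : Subgroup (GL (Fin 3) R) where
  carrier := {g | ∃ e f w : R, (g : Matrix (Fin 3) (Fin 3) R) = heisenbergMatrix e f w}
  mul_mem' := by
    rintro g h ⟨e, f, w, hg⟩ ⟨e', f', w', hh⟩
    exact ⟨_, _, _, by rw [Units.val_mul, hg, hh, heisenbergMatrix_mul]⟩
  one_mem' := ⟨0, 0, 0, by rw [heisenbergMatrix_zero]; rfl⟩
  inv_mem' := by
    rintro g ⟨e, f, w, hg⟩
    refine ⟨-e, -f, -w + e * f, ?_⟩
    apply Units.inv_eq_of_mul_eq_one_right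
    rw [hg, heisenbergMatrix_mul, ← heisenbergMatrix_zero]
    congr 1 <;> ring

/-- For an additive subgroup `L` of `R`, the subgroup of the Heisenberg group of `R` that consists
of the matrices with `e = f = 0` and `w ∈ L`. -/
def heisenbergCentral {R : Type*} [CommRing R] (L : AddSubgroup R) : Subgroup (heisenberg R) where
  carrier := {g | ∃ w ∈ L, (g.1 : Matrix (Fin 3) (Fin 3) R) = heisenbergMatrix 0 0 w}
  mul_mem' := by
    rintro g h ⟨w, hw, hg⟩ ⟨w', hw', hh⟩
    refine ⟨w + w', L.add_mem hw hw', ?_⟩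
    rw [Subgroup.coe_mul, Units.val_mul, hg, hh, heisenbergMatrix_mul]
    simp
  one_mem' := ⟨0, L.zero_mem, by rw [heisenbergMatrix_zero]; rfl⟩
  inv_mem' := by
    rintro g ⟨w, hw, hg⟩
    refine ⟨-w, L.neg_mem hw, ?_⟩
    rw [Subgroup.coe_inv]
    apply Units.inv_eq_of_mul_eq_one_right
    rw [hg, heisenbergMatrix_mul, ← heisenbergMatrix_zero]
    congr 1 <;> ring

instance heisenbergCentral_normal {R : Type*} [CommRing R] (L : AddSubgroup R) :
    (heisenbergCentral L).Normal where
  conj_mem := by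
    rintro g hg h
    obtain ⟨w, hw, hgw⟩ := hg
    obtain ⟨e, f, v, hh⟩ := h.2
    have hc : h * g = g * h := by
      apply Subtype.ext
      apply Units.ext
      rw [Subgroup.coe_mul, Subgroup.coe_mul, Units.val_mul, Units.val_mul, hgw, hh,
        heisenbergMatrix_mul, heisenbergMatrix_mul]
      congr 1 <;> ring
    rw [hc, mul_inv_cancel_right]
    exact ⟨w, hw, hgw⟩

/-! ### The flat groups -/

/-- The `2 × (m + 1)` matrix with rows `(e₁, …, e_m, 0)` and `(0, e₁, …, e_m)`. -/
def flatBlock {k : Type*} [Field k] {m : ℕ} (e : Fin m → k) : Matrix (Fin 2) (Fin (m + 1)) k :=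
  Matrix.of ![Fin.snoc (α := fun _ => k) e 0, Fin.cons (α := fun _ => k) 0 e]

theorem flatBlock_add {k : Type*} [Field k] {m : ℕ} (e e' : Fin m → k) :
    flatBlock (e + e') = flatBlock e + flatBlock e' := by
  ext i j
  fin_cases i
  · refine Fin.lastCases ?_ (fun j => ?_) j <;> simp [flatBlock]
  · refine Fin.cases ?_ (fun j => ?_) j <;> simp [flatBlock]

theorem flatBlock_zero {k : Type*} [Field k] {m : ℕ} : flatBlock (0 : Fin m → k) = 0 := by
  have h := flatBlock_add (0 : Fin m → k) 0
  rwa [add_zero, left_eq_add] at h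

/-- The matrix, with row and column blocks of sizes `2`, `m + 1` and `1`,
`[[I, flatBlock e, w], [0, I, f], [0, 0, 1]]`. -/
def flatMatrix {k : Type*} [Field k] {m : ℕ} (e : Fin m → k) (f : Fin (m + 1) → k)
    (w : Fin 2 → k) :
    Matrix (Fin 2 ⊕ Fin (m + 1) ⊕ Unit) (Fin 2 ⊕ Fin (m + 1) ⊕ Unit) k :=
  Matrix.fromBlocks 1 (Matrix.fromCols (flatBlock e) (Matrix.replicateCol Unit w)) 0
    (Matrix.fromBlocks 1 (Matrix.replicateCol Unit f) 0 1)

theorem flatMatrix_mul {k : Type*} [Field k] {m : ℕ} (e e' : Fin m → k)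
    (f f' : Fin (m + 1) → k) (w w' : Fin 2 → k) :
    flatMatrix e f w * flatMatrix e' f' w' =
      flatMatrix (e + e') (f + f') (w + w' + (flatBlock e).mulVec f') := by
  unfold flatMatrix
  rw [Matrix.fromBlocks_multiply, Matrix.fromBlocks_multiply,
    Matrix.fromCols_mul_fromBlocks, flatBlock_add]
  congr 1
  · simp
  · ext i j
    rcases j with j | j
    · simp [add_comm]
    · simp [Matrix.mul_apply, Matrix.mulVec, dotProduct]
      ring
  · simp
  · have h : Matrix.replicateCol Unit f' + Matrix.replicateCol Unit f =
        Matrix.replicateCol Unit (f + f') := by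
      ext i j
      simp [add_comm]
    simp [h]

theorem flatMatrix_zero {k : Type*} [Field k] {m : ℕ} :
    flatMatrix (0 : Fin m → k) 0 0 = 1 := by
  unfold flatMatrix
  rw [flatBlock_zero, ← Matrix.fromBlocks_one, ← Matrix.fromBlocks_one]
  congr 1
  · ext i j
    rcases j with j | j <;> simp

/-- The flat matrix group over `k` with parameter `m`. -/
def flatGroup (k : Type*) [Field k] (m : ℕ) : Subgroup (GL (Fin 2 ⊕ Fin (m + 1) ⊕ Unit) k) where
  carrier := {g | ∃ e f w,
    (g : Matrix (Fin 2 ⊕ Fin (m + 1) ⊕ Unit) (Fin 2 ⊕ Fin (m + 1) ⊕ Unit) k) = flatMatrix e f w}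
  mul_mem' := by
    rintro g h ⟨e, f, w, hg⟩ ⟨e', f', w', hh⟩
    exact ⟨_, _, _, by rw [Units.val_mul, hg, hh, flatMatrix_mul]⟩
  one_mem' := ⟨0, 0, 0, by rw [flatMatrix_zero]; rfl⟩
  inv_mem' := by
    rintro g ⟨e, f, w, hg⟩
    refine ⟨-e, -f, -w + (flatBlock e).mulVec f, ?_⟩
    apply Units.inv_eq_of_mul_eq_one_right
    rw [hg, flatMatrix_mul, ← flatMatrix_zero]
    congr 1
    · simp
    · simp
    · rw [Matrix.mulVec_neg]; abel

/-! ### Pencils of alternating forms -/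

/-! Coordinates on $[G,G]\cong k^2$ turn commutation into a pair of alternating forms $\varphi,\psi$
on $V=G/Z(G)$ without common radical, and central indecomposability of $G$ forbids splitting $V$
orthogonally for both forms. The theorem thus becomes the Kronecker-type classification of
indecomposable pencils of alternating forms over an arbitrary field.

The dichotomy is whether the pencil kills a nonzero polynomial vector (a chain). If it does not, a
Fitting-type splitting shows that $\varphi$ or $\psi$ itself is nondegenerate
(`injective_or_injective_of_regular`). Then, say, $T=\varphi^{-1}\psi$ is self-adjoint, its minimal
polynomial is a prime power, and $V$ is a module over $R=k[x]/(a^{c+1})$. Two suitable vectors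
generate a free nondegenerate submodule of rank 2, which splits off and so is $V$
(`exists_sloped_equiv`). If a chain exists, a shortest one and a dual sequence span a piece that
splits off and has the flat shape (`exists_flat_equiv`).

Finally, `isoclinic_of_presentation` turns equality of bimaps into isoclinism. -/

section Pencil

variable {k V : Type*} [Field k] [AddCommGroup V] [Module k V]

/-- A chain of length `n` for the pencil spanned by `φ` and `ψ`: the coefficients of a polynomial
vector of degree less than `n` in the kernel of the pencil. -/
def IsPencilChain (φ ψ : LinearMap.BilinForm k V) (n : ℕ) (γ : ℕ → V) : Prop :=
  φ (γ 0) = 0 ∧ (∀ j, φ (γ (j + 1)) = ψ (γ j)) ∧ ∀ j, n ≤ j → γ j = 0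

/-- The pencil spanned by `φ` and `ψ` is not an orthogonal sum of two nonzero pencils. -/
def OrthogonallyIndecomposable (φ ψ : LinearMap.BilinForm k V) : Prop :=
  ∀ P Q : Submodule k V, IsCompl P Q → (∀ x ∈ P, ∀ y ∈ Q, φ x y = 0 ∧ ψ x y = 0) →
    P = ⊥ ∨ Q = ⊥

theorem LinearMap.BilinForm.IsAlt.apply_swap {φ : LinearMap.BilinForm k V} (hφ : φ.IsAlt) (x y : V) :
    φ x y = -φ y x :=
  (LinearMap.BilinForm.IsAlt.neg_eq hφ y x).symm

theorem forall_eq_zero_of_finrank_map_eq [FiniteDimensional k V] {V' : Type*} [AddCommGroup V']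
    [Module k V'] {f : V →ₗ[k] V'} {p : Submodule k V}
    (h : Module.finrank k (p.map f) = Module.finrank k p) : ∀ v ∈ p, f v = 0 → v = 0 := by
  intro v hv hfv
  have h1 := LinearMap.finrank_range_add_finrank_ker (f.domRestrict p)
  rw [LinearMap.range_domRestrict, h] at h1
  have h2 : LinearMap.ker (f.domRestrict p) = ⊥ :=
    Submodule.finrank_eq_zero.mp (by omega)
  have h3 : (⟨v, hv⟩ : p) ∈ LinearMap.ker (f.domRestrict p) := hfv
  rw [h2, Submodule.mem_bot] at h3
  exact congrArg Subtype.val h3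

theorem finrank_map_eq_of_disjoint_ker [FiniteDimensional k V] {V' : Type*} [AddCommGroup V']
    [Module k V'] {f : V →ₗ[k] V'} {p : Submodule k V} (h : ∀ v ∈ p, f v = 0 → v = 0) :
    Module.finrank k (p.map f) = Module.finrank k p := by
  have hinj : Function.Injective (f.domRestrict p) := by
    rw [injective_iff_map_eq_zero]
    exact fun x hx => Subtype.ext (h x x.2 hx)
  rw [← LinearMap.range_domRestrict, LinearMap.finrank_range_of_inj hinj]

/-- The members of the generalized kernel of `φ` relative to `ψ`. -/
def pencilKernel (φ ψ : LinearMap.BilinForm k V) : ℕ → Submodule k V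
  | 0 => ⊥
  | n + 1 => ((pencilKernel φ ψ n).map ψ).comap φ

theorem pencilKernel_le_succ (φ ψ : LinearMap.BilinForm k V) (n : ℕ) :
    pencilKernel φ ψ n ≤ pencilKernel φ ψ (n + 1) := by
  induction n with
  | zero => exact bot_le
  | succ n ih => exact Submodule.comap_mono (Submodule.map_mono ih)

/-- Unwinding the nested preimages gives a chain ending in `v`, except that `ψ v = 0` may fail. When
it holds, padding with zeros yields a genuine chain. -/
theorem exists_sequence_of_mem_pencilKernel (φ ψ : LinearMap.BilinForm k V) (n : ℕ) :
    ∀ v ∈ pencilKernel φ ψ n,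
      ∃ γ : ℕ → V, γ n = v ∧ φ (γ 0) = 0 ∧ ∀ j < n, φ (γ (j + 1)) = ψ (γ j) := by
  induction n with
  | zero =>
    intro v hv
    rw [pencilKernel, Submodule.mem_bot] at hv
    exact ⟨0, by simp [hv], by simp, by simp⟩
  | succ n ih =>
    intro v hv
    obtain ⟨u, hu, huv⟩ := hv
    obtain ⟨γ, h1, h2, h3⟩ := ih u hu
    refine ⟨Function.update γ (n + 1) v, by simp, by simpa using h2, fun j hj => ?_⟩
    have hne : j ≠ n + 1 := by omega
    rcases Nat.lt_succ_iff_lt_or_eq.mp hj with hj | rfl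
    · rw [Function.update_of_ne (by omega), Function.update_of_ne hne, h3 j hj]
    · rw [Function.update_self, Function.update_of_ne hne, h1, huv]

theorem eq_zero_of_mem_pencilKernel {φ ψ : LinearMap.BilinForm k V}
    (h : ∀ n γ, IsPencilChain φ ψ n γ → γ = 0) {n : ℕ} {v : V}
    (hv : v ∈ pencilKernel φ ψ n) (hψ : ψ v = 0) : v = 0 := by
  obtain ⟨γ, h1, h2, h3⟩ := exists_sequence_of_mem_pencilKernel φ ψ n v hv
  have hc := h (n + 1) (fun j => if j ≤ n then γ j else 0) ⟨by simpa using h2, fun j => ?_,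
    fun j hj => if_neg (by omega)⟩
  · have := congrFun hc n
    simpa [h1] using this
  · rcases lt_trichotomy j n with hj | rfl | hj
    · simp [hj.le, Nat.succ_le_of_lt hj, h3 j hj]
    · simp [h1, hψ]
    · simp [show ¬ j ≤ n by omega, show ¬ j + 1 ≤ n by omega]

/-- An indecomposable regular pencil of alternating forms has a nondegenerate basis member. -/
theorem injective_or_injective_of_regular [FiniteDimensional k V] {φ ψ : LinearMap.BilinForm k V}
    (hφ : φ.IsAlt) (hψ : ψ.IsAlt) (hind : OrthogonallyIndecomposable φ ψ)
    (h : ∀ n γ, IsPencilChain φ ψ n γ → γ = 0) :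
    Function.Injective φ ∨ Function.Injective ψ := by
  obtain ⟨n, hn⟩ := monotone_stabilizes_iff_noetherian.mpr (inferInstanceAs (IsNoetherian k V))
    ⟨pencilKernel φ ψ, monotone_nat_of_le_succ (pencilKernel_le_succ φ ψ)⟩
  set K := pencilKernel φ ψ n with hK
  have hstep : ∀ x, x ∈ K ↔ φ x ∈ K.map ψ := by
    intro x
    have : K = pencilKernel φ ψ (n + 1) := hn (n + 1) (by omega)
    conv_lhs => rw [this]
    rfl
  have hinjK : ∀ v ∈ K, ψ v = 0 → v = 0 := fun v hv h0 => eq_zero_of_mem_pencilKernel h hv h0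
  -- `M` is the `ψ`-orthogonal of `K`. Since `φ` maps `K` into `ψ K`, it is `φ`-orthogonal to `K` as
  -- well.
  set M := (K.map ψ).dualCoannihilator with hM
  have hmemM : ∀ x, x ∈ M ↔ ∀ u ∈ K, ψ u x = 0 := by
    intro x
    rw [hM, Submodule.mem_dualCoannihilator]
    exact ⟨fun h u hu => h _ ⟨u, hu, rfl⟩, by rintro h _ ⟨u, hu, rfl⟩; exact h u hu⟩
  have horth : ∀ x ∈ K, ∀ y ∈ M, φ x y = 0 ∧ ψ x y = 0 := by
    intro x hx y hy
    refine ⟨?_, (hmemM y).mp hy x hx⟩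
    obtain ⟨u, hu, hux⟩ := (hstep x).mp hx
    rw [← hux]
    exact (hmemM y).mp hy u hu
  have hdimK : Module.finrank k K + Module.finrank k M = Module.finrank k V := by
    rw [← Subspace.finrank_add_finrank_dualCoannihilator_eq (K.map ψ),
      finrank_map_eq_of_disjoint_ker (p := K) (f := ψ) hinjK]
  -- By double annihilation, `φ x` lies in `ψ K` exactly when it kills `M`, so `K` is also the
  -- `φ`-orthogonal of `M`. Counting dimensions, `φ` is injective on `M`.
  have hKM : (M.map φ).dualCoannihilator = K := by
    ext x
    rw [hstep, ← Subspace.dualCoannihilator_dualAnnihilator_eq (W := K.map ψ),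
      Submodule.mem_dualCoannihilator, Submodule.mem_dualAnnihilator]
    constructor
    · intro h y hy
      rw [hφ.apply_swap, h _ ⟨y, hy, rfl⟩, neg_zero]
    · rintro h _ ⟨y, hy, rfl⟩
      rw [hφ.apply_swap, h y hy, neg_zero]
  have hinjM : ∀ v ∈ M, φ v = 0 → v = 0 := by
    have h1 := Subspace.finrank_add_finrank_dualCoannihilator_eq (M.map φ)
    rw [hKM] at h1
    have h2 : Module.finrank k (M.map φ) = Module.finrank k M :=
      Nat.add_right_cancel ((h1.trans hdimK.symm).trans (Nat.add_comm _ _))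
    exact forall_eq_zero_of_finrank_map_eq h2
  -- Descent along the filtration: for `v` in `K ∩ M` at level `i + 1`, the `u` with `φ u' = ψ u` at
  -- `u' = v` lies in `K ∩ M` at level `i`. By induction `u = 0`, so `φ v = 0` and `v = 0`.
  have hdisj : ∀ i, ∀ v ∈ pencilKernel φ ψ i, v ∈ M → v ∈ K → v = 0 := by
    intro i
    induction i with
    | zero => exact fun v hv _ _ => by simpa [pencilKernel] using hv
    | succ i ih =>
      intro v hv hvM hvK
      obtain ⟨u, hu, huv⟩ := hv
      have huK : u ∈ K := by
        obtain ⟨u', hu', h'⟩ := (hstep v).mp hvK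
        have : u = u' := by
          by_cases hi : i ≤ n
          · have hle : pencilKernel φ ψ i ≤ K :=
              monotone_nat_of_le_succ (pencilKernel_le_succ φ ψ) hi
            exact sub_eq_zero.mp (hinjK _ (K.sub_mem (hle hu) hu') (by rw [map_sub, huv, h', sub_self]))
          · have : K = pencilKernel φ ψ i := hn i (by omega)
            rw [← this] at hu
            exact sub_eq_zero.mp (hinjK _ (K.sub_mem hu hu') (by rw [map_sub, huv, h', sub_self]))
        exact this ▸ hu'
      have huM : u ∈ M := by
        rw [hmemM]
        intro y hy
        rw [hψ.apply_swap, huv, hφ.apply_swap, (horth y hy v hvM).1, neg_zero, neg_zero]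
      rw [ih u hu huM huK, map_zero] at huv
      exact hinjM v hvM huv.symm
  have hcompl : IsCompl K M := by
    have hd : Disjoint K M := Submodule.disjoint_def.mpr fun x hx hxM => hdisj n x hx hxM hx
    refine ⟨hd, codisjoint_iff.mpr (Submodule.eq_top_of_finrank_eq ?_)⟩
    have := Submodule.finrank_sup_add_finrank_inf_eq K M
    rw [hd.eq_bot, finrank_bot] at this
    omega
  rcases hind K M hcompl horth with hK0 | hM0
  · left
    rw [injective_iff_map_eq_zero]
    intro v hv
    have : v ∈ K := (hstep v).mpr (hv ▸ Submodule.zero_mem _)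
    rwa [hK0, Submodule.mem_bot] at this
  · right
    have hKtop : K = ⊤ := by simpa [hM0] using hcompl.sup_eq_top
    rw [injective_iff_map_eq_zero]
    exact fun v hv => hinjK v (hKtop ▸ Submodule.mem_top) hv

/-- The relation moves both indices inwards: $\psi(w_i,w_{i+d+2})=\psi(w_{i+1},w_{i+1+d})$. The gap
falls to 0 or 1, where alternation of `ψ` or `φ` gives zero, in every characteristic. -/
theorem isotropic_of_pencil_sequence {φ ψ : LinearMap.BilinForm k V} (hφ : φ.IsAlt) (hψ : ψ.IsAlt)
    {w : ℕ → V} {n : ℕ} (h : ∀ j < n, φ (w j) = ψ (w (j + 1))) {i j : ℕ} (hi : i ≤ n)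
    (hj : j ≤ n) : φ (w i) (w j) = 0 ∧ ψ (w i) (w j) = 0 := by
  have key : ∀ d i, i + d ≤ n → ψ (w i) (w (i + d)) = 0 := by
    intro d
    induction d using Nat.strong_induction_on with
    | _ d ih =>
      intro i hid
      match d with
      | 0 => exact hψ _
      | 1 => rw [hψ.apply_swap, ← h i (by omega), hφ, neg_zero]
      | d + 2 =>
        have h1 : ψ (w i) (w (i + (d + 2))) = ψ (w (i + 1)) (w (i + 1 + d)) := by
          rw [hψ.apply_swap, show i + (d + 2) = (i + 1 + d) + 1 by ring, ← h _ (by omega),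
            hφ.apply_swap, neg_neg, h i (by omega)]
        rw [h1]
        exact ih d (by omega) _ (by omega)
  have hall : ∀ i j, i ≤ n → j ≤ n → ψ (w i) (w j) = 0 := by
    intro i j hi hj
    rcases le_total i j with hij | hij
    · obtain ⟨d, rfl⟩ := Nat.exists_eq_add_of_le hij
      exact key d i hj
    · obtain ⟨d, rfl⟩ := Nat.exists_eq_add_of_le hij
      rw [hψ.apply_swap, key d j hi, neg_zero]
  refine ⟨?_, hall i j hi hj⟩
  rcases hi.lt_or_eq with hi' | rfl
  · rw [h i hi', hall _ _ hi' hj]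
  · rcases hj.lt_or_eq with hj' | rfl
    · rw [hφ.apply_swap, h j hj', hall _ _ hj' hi, neg_zero]
    · exact hφ _

/-- Dually to a chain `v` of minimal length, there is a sequence `w` pairing nontrivially with it. -/
theorem exists_dual_sequence [FiniteDimensional k V] {φ ψ : LinearMap.BilinForm k V}
    (hφ : φ.IsAlt) (hψ : ψ.IsAlt) {n : ℕ} (hmin : ∀ γ, IsPencilChain φ ψ (n + 1) γ → γ = 0)
    {v₀ v₁ : V} (hv₀ : v₀ ≠ 0) (h₀ : φ v₀ = 0) (h₁ : φ v₁ = ψ v₀) :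
    ∃ w : ℕ → V, (∀ j < n, φ (w j) = ψ (w (j + 1))) ∧ φ v₁ (w 0) = 1 := by
  -- The kernel of `T` consists of the sequences satisfying the required relation, so it suffices
  -- that `l` not vanish on it.
  let T : (Fin (n + 1) → V) →ₗ[k] (Fin n → Module.Dual k V) :=
    LinearMap.pi fun j => φ ∘ₗ LinearMap.proj j.castSucc - ψ ∘ₗ LinearMap.proj j.succ
  have hT : ∀ w j, T w j = φ (w j.castSucc) - ψ (w j.succ) := fun w j => rfl
  let l : Module.Dual k (Fin (n + 1) → V) := φ v₁ ∘ₗ LinearMap.proj 0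
  have hl : ∀ w, l w = φ v₁ (w 0) := fun w => rfl
  by_cases hw : ∃ w, T w = 0 ∧ l w ≠ 0
  · obtain ⟨w, hTw, hlw⟩ := hw
    refine ⟨fun j => if hj : j < n + 1 then (l w)⁻¹ • w ⟨j, hj⟩ else 0, fun j hj => ?_, ?_⟩
    · have := congrFun hTw ⟨j, hj⟩
      rw [hT, Pi.zero_apply, sub_eq_zero] at this
      beta_reduce
      rw [dif_pos (by omega), dif_pos (by omega), map_smul, map_smul]
      exact congrArg _ this
    · beta_reduce
      rw [dif_pos (by omega), map_smul, smul_eq_mul]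
      exact inv_mul_cancel₀ hlw
  · exfalso
    push Not at hw
    -- Otherwise `l` factors through `T`. By reflexivity of `V` the factor is given by vectors `c
    -- j`, and testing on sequences concentrated at one index shows that `v₀, -c 0, -c 1, …` is a
    -- chain of length `n + 1`, against minimality.
    have hmem : l ∈ LinearMap.range T.dualMap := by
      rw [LinearMap.range_dualMap_eq_dualAnnihilator_ker, Submodule.mem_dualAnnihilator]
      exact fun w h => hw w h
    obtain ⟨lam, hlam⟩ := hmem
    let γ : Fin n → V := fun j =>
      (Module.evalEquiv k V).symm (lam ∘ₗ LinearMap.single k (fun _ => Module.Dual k V) j)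
    have hγ : ∀ d : Fin n → Module.Dual k V, lam d = ∑ j, d j (γ j) := by
      intro d
      conv_lhs => rw [← Finset.univ_sum_single d]
      rw [map_sum]
      refine Finset.sum_congr rfl fun j _ => ?_
      rw [Module.apply_evalEquiv_symm_apply]
      rfl
    let c : ℕ → V := fun j => if h : j < n then γ ⟨j, h⟩ else 0
    have hc : ∀ j, n ≤ j → c j = 0 := fun j hj => dif_neg (by omega)
    have hsum : ∀ w : ℕ → V, φ v₁ (w 0) =
        ∑ j ∈ Finset.range n, (φ (w j) (c j) - ψ (w (j + 1)) (c j)) := by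
      intro w
      have := LinearMap.congr_fun hlam (fun i => w i)
      rw [LinearMap.dualMap_apply, hγ, hl] at this
      rw [← Fin.sum_univ_eq_sum_range (fun j => φ (w j) (c j) - ψ (w (j + 1)) (c j))]
      refine this.symm.trans (Finset.sum_congr rfl fun j _ => ?_)
      rw [hT]
      simp [c]
    have h1 : ∀ i x, ∑ j ∈ Finset.range n, φ (Pi.single (M := fun _ => V) i x j) (c j)
        = φ x (c i) := by
      intro i x
      rw [Finset.sum_eq_single i]
      · simp
      · intro j _ hj
        simp [hj]
      · intro hi
        simp [hc i (by simpa using hi)]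
    have h2 : ∀ i x, ∑ j ∈ Finset.range n, ψ (Pi.single (M := fun _ => V) (i + 1) x (j + 1)) (c j)
        = ψ x (c i) := by
      intro i x
      rw [Finset.sum_eq_single i]
      · simp
      · intro j _ hj
        simp [hj]
      · intro hi
        simp [hc i (by simpa using hi)]
    simp only [Finset.sum_sub_distrib] at hsum
    have hchain := hmin (fun j => Nat.casesOn j v₀ fun i => - c i) ⟨h₀, ?_, ?_⟩
    · exact hv₀ (congrFun hchain 0)
    · rintro (_ | i)
      · ext x
        have := hsum (Pi.single 0 x)
        rw [h1] at this
        simp at this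
        change φ (-c 0) x = ψ v₀ x
        rw [← h₁, this, map_neg, LinearMap.neg_apply]
        rw [hφ.apply_swap, neg_neg]
      · ext x
        have := hsum (Pi.single (i + 1) x)
        rw [h1, h2] at this
        simp at this
        change φ (-c (i + 1)) x = ψ (-c i) x
        rw [map_neg, map_neg, LinearMap.neg_apply, LinearMap.neg_apply]
        rw [hφ.apply_swap, hψ.apply_swap, neg_neg, neg_neg]
        exact sub_eq_zero.mp this.symm
    · rintro (_ | j) hj
      · omega
      · simp [hc j (by omega)]

end Pencil

/-! ### Singular pencils: a shortest chain and its dual sequence. -/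

section Flat

variable {k V : Type*} [Field k] [AddCommGroup V] [Module k V]

/-- A shortest nonzero chain. -/
theorem exists_minimal_chain {φ ψ : LinearMap.BilinForm k V}
    (hnd : ∀ x, φ x = 0 → ψ x = 0 → x = 0)
    (h : ¬ ∀ n γ, IsPencilChain φ ψ n γ → γ = 0) :
    ∃ n v, IsPencilChain φ ψ (n + 2) v ∧ v 0 ≠ 0 ∧
      ∀ γ, IsPencilChain φ ψ (n + 1) γ → γ = 0 := by
  classical
  have hex : ∃ n γ, IsPencilChain φ ψ n γ ∧ γ ≠ 0 := by
    push Not at h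
    exact h
  obtain ⟨v, hv, hv0⟩ := Nat.find_spec hex
  have hmin : ∀ i < Nat.find hex, ∀ γ, IsPencilChain φ ψ i γ → γ = 0 := by
    intro i hi γ hγ
    by_contra hne
    exact Nat.find_min hex hi ⟨γ, hγ, hne⟩
  obtain ⟨h1, h2, h3⟩ := hv
  match hN : Nat.find hex with
  | 0 => exact absurd (funext fun j => h3 j (by omega)) hv0
  | 1 =>
    refine absurd (funext fun j => ?_) hv0
    rcases j with _ | j
    · refine hnd _ h1 ?_
      rw [← h2, h3 1 (by omega), map_zero]
    · exact h3 _ (by omega)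
  | n + 2 =>
    rw [hN] at h3
    refine ⟨n, v, ⟨h1, h2, h3⟩, fun h0 => hv0 ?_, hmin (n + 1) (by omega)⟩
    -- If `v 0 = 0`, the shifted sequence is a shorter chain.
    have := hmin (n + 1) (by omega) (fun j => v (j + 1))
      ⟨by rw [h2, h0, map_zero], fun j => h2 _, fun j hj => h3 _ (by omega)⟩
    funext j
    rcases j with _ | j
    · exact h0
    · exact congrFun this j

/-- The pairing `ψ (v i) (w j)` is unchanged when both indices shift. Sliding down to `v 0` settles
`i < j` and `i = j`; sliding up to `w n` carries `v` past the end of the chain when `i > j`. -/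
theorem pairing_of_dual_sequence {φ ψ : LinearMap.BilinForm k V} (hφ : φ.IsAlt) (hψ : ψ.IsAlt)
    {n : ℕ} {v w : ℕ → V} (hv : IsPencilChain φ ψ (n + 2) v)
    (hw : ∀ j < n, φ (w j) = ψ (w (j + 1))) (h1 : φ (v 1) (w 0) = 1) (i j : ℕ) (hj : j ≤ n) :
    ψ (v i) (w j) = if i = j then 1 else 0 := by
  obtain ⟨hv0, hvs, hvn⟩ := hv
  have hshift : ∀ t i j, j + t ≤ n → ψ (v (i + t)) (w (j + t)) = ψ (v i) (w j) := by
    intro t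
    induction t with
    | zero => exact fun i j _ => rfl
    | succ t ih =>
      intro i j h
      rw [← ih i j (by omega), ← hvs (i + t), hφ.apply_swap, hw _ (by omega), ← hψ.apply_swap]
      rfl
  rcases lt_trichotomy i j with hij | rfl | hij
  · obtain ⟨d, rfl⟩ := Nat.exists_eq_add_of_lt hij
    have := hshift i 0 (d + 1) (by omega)
    rw [zero_add, hψ.apply_swap (v 0), ← hw d (by omega), hφ.apply_swap, hv0] at this
    rw [if_neg (by omega), show i + d + 1 = d + 1 + i by ring, this]
    simp
  · have := hshift i 0 0 (by omega)
    rw [zero_add] at this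
    rw [this, if_pos rfl, ← h1, hvs 0]
  · rw [if_neg hij.ne', ← hshift (n - j) i j (by omega), ← hvs, hvn _ (by omega)]
    simp

/-- An indecomposable singular pencil is that of a flat group. -/
theorem exists_flat_equiv [FiniteDimensional k V] {φ ψ : LinearMap.BilinForm k V}
    (hφ : φ.IsAlt) (hψ : ψ.IsAlt) (hind : OrthogonallyIndecomposable φ ψ)
    (hnd : ∀ x, φ x = 0 → ψ x = 0 → x = 0)
    (h : ¬ ∀ n γ, IsPencilChain φ ψ n γ → γ = 0) :
    ∃ (n : ℕ) (s : ((Fin (n + 1) → k) × (Fin (n + 2) → k)) ≃ₗ[k] V), ∀ x y,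
      ![- ψ (s x) (s y), - φ (s x) (s y)] =
        (flatBlock x.1).mulVec y.2 - (flatBlock y.1).mulVec x.2 := by
  obtain ⟨n, v, hv, hv0, hmin⟩ := exists_minimal_chain hnd h
  have hvc := hv
  obtain ⟨c0, cs, cn⟩ := hvc
  obtain ⟨w, hw, hw1⟩ := exists_dual_sequence hφ hψ hmin hv0 c0 (cs 0)
  have hvw := pairing_of_dual_sequence hφ hψ hv hw hw1
  have hvw' : ∀ i j, j ≤ n → φ (v i) (w j) = if i = j + 1 then 1 else 0 := by
    intro i j hj
    rcases i with _ | i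
    · simp [c0]
    · rw [cs, hvw i j hj]
      simp
  have hww : ∀ i j : Fin (n + 1), φ (w i) (w j) = 0 ∧ ψ (w i) (w j) = 0 := fun i j =>
    isotropic_of_pencil_sequence hφ hψ hw (Fin.is_le i) (Fin.is_le j)
  -- A chain satisfies the same relation as `w` with the two forms exchanged.
  have hvv : ∀ i j : Fin (n + 2), φ (v i) (v j) = 0 ∧ ψ (v i) (v j) = 0 := fun i j =>
    (isotropic_of_pencil_sequence (n := n + 1) hψ hφ (fun j _ => (cs j).symm) (Fin.is_le i)
      (Fin.is_le j)).symm
  let s : ((Fin (n + 1) → k) × (Fin (n + 2) → k)) →ₗ[k] V :=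
    (Fintype.linearCombination k fun i : Fin (n + 1) => w i).coprod
      (Fintype.linearCombination k fun i : Fin (n + 2) => v i)
  have hs : ∀ x, s x = ∑ i : Fin (n + 1), x.1 i • w i + ∑ i : Fin (n + 2), x.2 i • v i :=
    fun x => rfl
  -- Biorthogonality lets `c` read off coordinates, so it is a left inverse of `s`, and its kernel
  -- is a complement of the range of `s`.
  let c : V →ₗ[k] ((Fin (n + 1) → k) × (Fin (n + 2) → k)) :=
    (LinearMap.pi fun i : Fin (n + 1) => ψ (v i)).prod
      (LinearMap.pi fun i : Fin (n + 2) => -Fin.cases (ψ (w 0)) (fun j => φ (w j)) i)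
  have hcs : ∀ x, c (s x) = x := by
    intro x
    refine Prod.ext (funext fun i => ?_) (funext fun i => ?_)
    · change ψ (v i) (s x) = _
      have h1 : ∀ j : Fin (n + 1), ψ (v i) (w j) = if j = i then 1 else 0 := by
        intro j
        rw [hvw _ _ (Fin.is_le _)]
        exact if_congr (by rw [Fin.ext_iff, eq_comm]) rfl rfl
      have h2 : ∀ j : Fin (n + 2), ψ (v i) (v j) = 0 := fun j => (hvv i.castSucc j).2
      simp [hs, h1, h2]
    · induction i using Fin.cases with
      | zero =>
        change -ψ (w 0) (s x) = _
        have h1 : ∀ j : Fin (n + 2), ψ (w 0) (v j) = -if j = 0 then 1 else 0 := by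
          intro j
          rw [hψ.apply_swap, hvw _ _ (by omega)]
          exact congrArg Neg.neg (if_congr (Fin.ext_iff (b := 0)).symm rfl rfl)
        have h2 := fun j => (hww 0 j).2
        simp only [Fin.val_zero] at h2
        simp [hs, h1, h2]
      | succ i =>
        change -φ (w i) (s x) = _
        have h1 : ∀ j : Fin (n + 2), φ (w i) (v j) = -if j = i.succ then 1 else 0 := by
          intro j
          rw [hφ.apply_swap, hvw' _ _ (Fin.is_le _)]
          simp [Fin.ext_iff]
        simp [hs, h1, hww]
  have hcompl : IsCompl (LinearMap.range s) (LinearMap.ker c) := by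
    refine ⟨Submodule.disjoint_def.mpr ?_, codisjoint_iff_le_sup.mpr fun x _ => Submodule.mem_sup.mpr ?_⟩
    · rintro _ ⟨x, rfl⟩ hx
      rw [LinearMap.mem_ker, hcs] at hx
      rw [hx, map_zero]
    · exact ⟨s (c x), ⟨_, rfl⟩, x - s (c x), by simp [hcs], by simp⟩
  have hφv : ∀ (y : V) (_ : c y = 0) (i : ℕ), ψ (v i) y = 0 := by
    intro y hy i
    rcases lt_or_ge i (n + 1) with hi | hi
    · exact congrFun (congrArg Prod.fst hy) ⟨i, hi⟩
    · rw [← cs, cn _ (by omega)]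
      simp
  -- `c` uses only some of the pairings; the chain relations make the remaining ones vanish on its
  -- kernel too.
  have horth : ∀ x ∈ LinearMap.range s, ∀ y ∈ LinearMap.ker c, φ x y = 0 ∧ ψ x y = 0 := by
    rintro _ ⟨x, rfl⟩ y hy
    have e1 := hφv y hy
    have e2 : ∀ i, φ (v i) y = 0 := by
      rintro (_ | i)
      · simp [c0]
      · rw [cs, e1]
    have e3 : ∀ i : Fin (n + 1), φ (w i) y = 0 := fun i =>
      neg_eq_zero.mp (congrFun (congrArg Prod.snd hy) i.succ)
    have e4 : ∀ i : Fin (n + 1), ψ (w i) y = 0 := by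
      intro i
      induction i using Fin.cases with
      | zero => exact neg_eq_zero.mp (congrFun (congrArg Prod.snd hy) 0)
      | succ i =>
        have := e3 i.castSucc
        rwa [Fin.val_castSucc, hw _ i.2] at this
    simp [hs, e1, e2, e3, e4]
  have hbij : Function.Bijective s := by
    refine ⟨Function.LeftInverse.injective hcs, ?_⟩
    rw [← LinearMap.range_eq_top]
    rcases hind _ _ hcompl horth with h0 | h0
    · have hmem : s (0, Pi.single 0 1) ∈ LinearMap.range s := ⟨_, rfl⟩
      rw [h0, Submodule.mem_bot] at hmem
      have := congrFun (congrArg Prod.snd ((hcs _).symm.trans ((congrArg c hmem).trans (map_zero c)))) 0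
      simp at this
    · simpa [h0] using hcompl.sup_eq_top
  refine ⟨n, LinearEquiv.ofBijective s hbij, fun x y => ?_⟩
  have hwv : ∀ (i : Fin (n + 1)) (j : Fin (n + 2)), ψ (w i) (v j) =
      -if j = i.castSucc then 1 else 0 := by
    intro i j
    rw [hψ.apply_swap, hvw _ _ (Fin.is_le _)]
    simp [Fin.ext_iff]
  have hwv' : ∀ (i : Fin (n + 1)) (j : Fin (n + 2)), φ (w i) (v j) =
      -if j = i.succ then 1 else 0 := by
    intro i j
    rw [hφ.apply_swap, hvw' _ _ (Fin.is_le _)]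
    simp [Fin.ext_iff]
  have hvwF : ∀ (i : Fin (n + 2)) (j : Fin (n + 1)), ψ (v i) (w j) =
      if i = j.castSucc then 1 else 0 := by
    intro i j
    rw [hvw _ _ (Fin.is_le _)]
    simp [Fin.ext_iff]
  have hvwF' : ∀ (i : Fin (n + 2)) (j : Fin (n + 1)), φ (v i) (w j) =
      if i = j.succ then 1 else 0 := by
    intro i j
    rw [hvw' _ _ (Fin.is_le _)]
    simp [Fin.ext_iff]
  have e1 : ψ (s x) (s y) = ∑ i : Fin (n + 1), (y.1 i * x.2 i.castSucc - x.1 i * y.2 i.castSucc) := by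
    simp [hs, hww, hvv, hwv, hvwF, Finset.sum_sub_distrib, Finset.mul_sum]
    rw [Finset.sum_comm]
    simp [mul_comm]
    ring
  have e2 : φ (s x) (s y) = ∑ i : Fin (n + 1), (y.1 i * x.2 i.succ - x.1 i * y.2 i.succ) := by
    simp [hs, hww, hvv, hwv', hvwF', Finset.sum_sub_distrib, Finset.mul_sum]
    rw [Finset.sum_comm]
    simp [mul_comm]
    ring
  rw [LinearEquiv.ofBijective_apply, LinearEquiv.ofBijective_apply, e1, e2]
  funext l
  fin_cases l
  · simp [flatBlock, dotProduct, Fin.sum_univ_castSucc (n := n + 1)]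
  · simp [flatBlock, dotProduct, Fin.sum_univ_succ (n := n + 1)]

end Flat

/-! ### Pencils with a nondegenerate member, as modules over $k[x]/(a^{c+1})$. -/

section Sloped

variable {k : Type*} [Field k]

/-- Every nonzero element of `k[x]/(a ^ (c + 1))` has a multiple equal to `a ^ c`. -/
theorem exists_mul_eq_mk_pow {a : k[X]} (ha : Irreducible a) {c : ℕ}
    {s : AdjoinRoot (a ^ (c + 1))} (hs : s ≠ 0) :
    ∃ r, r * s = AdjoinRoot.mk (a ^ (c + 1)) (a ^ c) := by
  obtain ⟨p, rfl⟩ := AdjoinRoot.mk_surjective s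
  have hp : p ≠ 0 := by
    rintro rfl
    exact hs (map_zero _)
  obtain ⟨u, hu, hau⟩ := (FiniteMultiplicity.of_not_isUnit ha.not_isUnit hp).exists_eq_pow_mul_and_not_dvd
  set i := multiplicity a p
  have hi : i ≤ c := by
    by_contra hlt
    apply hs
    rw [AdjoinRoot.mk_eq_zero, hu]
    exact (pow_dvd_pow a (by omega)).mul_right u
  -- With $p=a^iu$ and `u` prime to `a`, the multiplier inverts `u` modulo $a^{c+1}$ and supplies
  -- the missing $a^{c-i}$.
  obtain ⟨y, z, hyz⟩ := ((ha.coprime_iff_not_dvd.mpr hau).pow_left (m := c + 1)).symm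
  refine ⟨AdjoinRoot.mk _ (y * a ^ (c - i)), ?_⟩
  rw [← map_mul, ← sub_eq_zero, ← map_sub, AdjoinRoot.mk_eq_zero]
  have h1 : y * a ^ (c - i) * p = y * u * a ^ c := by
    conv_lhs => rw [hu, ← mul_assoc, mul_assoc y, ← pow_add, Nat.sub_add_cancel hi]
    ring
  refine ⟨-(z * a ^ c), ?_⟩
  rw [h1]
  linear_combination a ^ c * hyz

variable {V : Type*} [AddCommGroup V] [Module k V]

theorem aeval_selfAdjoint {φ : LinearMap.BilinForm k V} {T : Module.End k V}
    (hT : ∀ x y, φ (T x) y = φ x (T y)) (p : k[X]) (x y : V) :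
    φ (aeval T p x) y = φ x (aeval T p y) := by
  induction p using Polynomial.induction_on' generalizing x y with
  | add p q hp hq => simp [hp, hq]
  | monomial n r =>
    have : ∀ x y, φ ((T ^ n) x) y = φ x ((T ^ n) y) := by
      induction n with
      | zero => simp
      | succ n ih =>
        intro x y
        rw [pow_succ, Module.End.mul_apply, ih, hT, ← Module.End.mul_apply, ← pow_succ', pow_succ]
    simp [aeval_monomial, Module.algebraMap_end_eq_smul_id, this]

/-- Self-adjointness gives $\varphi(T^{n+2}x,x)=\varphi(T^n(Tx),Tx)$, leaving exponents 0 and 1.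
Exponent 1 is a separate hypothesis because self-adjointness does not imply it in characteristic 2.
-/
theorem aeval_isotropic {φ : LinearMap.BilinForm k V} (hφ : φ.IsAlt) {T : Module.End k V}
    (hT : ∀ x y, φ (T x) y = φ x (T y)) (hT' : ∀ x, φ (T x) x = 0) (p : k[X]) (x : V) :
    φ (aeval T p x) x = 0 := by
  have hpow : ∀ n x, φ ((T ^ n) x) x = 0 := by
    intro n
    induction n using Nat.strong_induction_on with
    | _ n ih =>
      intro x
      match n with
      | 0 => exact hφ x
      | 1 => exact hT' x
      | n + 2 =>
        rw [pow_succ', Module.End.mul_apply, hT, pow_succ, Module.End.mul_apply]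
        exact ih n (by omega) (T x)
  induction p using Polynomial.induction_on' with
  | add p q hp hq => simp [hp, hq]
  | monomial n r => simp [aeval_monomial, Module.algebraMap_end_eq_smul_id, hpow]

/-- An endomorphism that generates, with `φ`, an indecomposable pencil has as its minimal polynomial
a power of an irreducible polynomial. -/
theorem exists_irreducible_pow_annihilates [FiniteDimensional k V] [Nontrivial V]
    {φ ψ : LinearMap.BilinForm k V}
    (hind : OrthogonallyIndecomposable φ ψ) {T : Module.End k V}
    (hT : ∀ x y, φ (T x) y = φ x (T y)) (hψ : ∀ x y, ψ x y = φ x (T y)) :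
    ∃ (a : k[X]) (c : ℕ), Irreducible a ∧ aeval T (a ^ (c + 1)) = 0 ∧ aeval T (a ^ c) ≠ 0 := by
  have hint : IsIntegral k T := Algebra.IsIntegral.isIntegral T
  have hne : minpoly k T ≠ 0 := minpoly.ne_zero hint
  obtain ⟨a, ha, hdvd⟩ := WfDvdMonoid.exists_irreducible_factor (minpoly.not_isUnit k T) hne
  obtain ⟨b, hb, hab⟩ := (FiniteMultiplicity.of_not_isUnit ha.not_isUnit hne).exists_eq_pow_mul_and_not_dvd
  obtain ⟨c, hc⟩ : ∃ c, multiplicity a (minpoly k T) = c + 1 := by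
    refine Nat.exists_eq_succ_of_ne_zero fun h0 => hab ?_
    rw [h0, pow_zero, one_mul] at hb
    rwa [← hb]
  rw [hc] at hb
  have hcop : IsCoprime (a ^ (c + 1)) b := (ha.coprime_iff_not_dvd.mpr hab).pow_left
  -- The coprime factors of the minimal polynomial split `V`. Self-adjointness makes the pieces
  -- `φ`-orthogonal, and stability under `T` makes them `ψ`-orthogonal; so one piece is zero.
  have hcompl : IsCompl (LinearMap.ker (aeval T (a ^ (c + 1)))) (LinearMap.ker (aeval T b)) := by
    refine ⟨Polynomial.disjoint_ker_aeval_of_isCoprime T hcop, codisjoint_iff.mpr ?_⟩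
    rw [Polynomial.sup_ker_aeval_eq_ker_aeval_mul_of_coprime T hcop, ← hb, minpoly.aeval]
    exact LinearMap.ker_zero
  have hφo : ∀ x ∈ LinearMap.ker (aeval T (a ^ (c + 1))), ∀ y ∈ LinearMap.ker (aeval T b),
      φ x y = 0 := by
    intro x hx y hy
    obtain ⟨u, z, huz⟩ := hcop
    have hx' : x = aeval T (z * b) x := by
      conv_lhs => rw [← Module.End.one_apply (R := k) x, ← map_one (aeval (R := k) T), ← huz]
      rw [map_add, LinearMap.add_apply, map_mul _ u, Module.End.mul_apply, LinearMap.mem_ker.mp hx,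
        map_zero, zero_add]
    rw [hx', aeval_selfAdjoint hT, map_mul, Module.End.mul_apply, LinearMap.mem_ker.mp hy, map_zero,
      map_zero]
  have hmin : ∀ p, aeval T p = 0 → a ^ (c + 1) * b ∣ p := fun p hp => hb ▸ minpoly.dvd k T hp
  have hTker : ∀ y ∈ LinearMap.ker (aeval T b), T y ∈ LinearMap.ker (aeval T b) := by
    intro y hy
    rw [LinearMap.mem_ker] at hy ⊢
    have := LinearMap.congr_fun (congrArg (aeval T) (mul_comm b X)) y
    simpa [hy] using this
  rcases hind _ _ hcompl fun x hx y hy =>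
    ⟨hφo x hx y hy, by rw [hψ]; exact hφo x hx _ (hTker y hy)⟩ with h0 | h0
  · exfalso
    have htop := hcompl.sup_eq_top
    rw [h0, bot_sup_eq] at htop
    have h1 := hmin b (LinearMap.ker_eq_top.mp htop)
    exact hab (((dvd_pow_self a c.succ_ne_zero).mul_right b).trans h1)
  · have htop := hcompl.sup_eq_top
    rw [h0, sup_bot_eq] at htop
    refine ⟨a, c, ha, LinearMap.ker_eq_top.mp htop, fun h1 => ?_⟩
    have h2 := (Dvd.intro _ rfl).trans (hmin _ h1)
    exact absurd ((pow_dvd_pow_iff ha.ne_zero ha.not_isUnit).mp h2) (by omega)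

/-- An indecomposable pencil with a nondegenerate member is that of a central quotient of a
Heisenberg group over `k[x]/(a ^ c)`. -/
theorem exists_sloped_equiv [FiniteDimensional k V] [Nontrivial V] {φ ψ : LinearMap.BilinForm k V}
    (hφ : φ.IsAlt) (hψ : ψ.IsAlt) (hind : OrthogonallyIndecomposable φ ψ)
    (hinj : Function.Injective φ) :
    ∃ (a : k[X]) (c : ℕ) (_ : Irreducible a) (l : AdjoinRoot (a ^ (c + 1)) →ₗ[k] k)
      (s : (AdjoinRoot (a ^ (c + 1)) × AdjoinRoot (a ^ (c + 1))) ≃ₗ[k] V), ∀ x y,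
      φ (s x) (s y) = l (x.1 * y.2 - y.1 * x.2) ∧
      ψ (s x) (s y) = l (AdjoinRoot.root _ * (x.1 * y.2 - y.1 * x.2)) := by
  let e : V ≃ₗ[k] Module.Dual k V :=
    LinearEquiv.ofInjectiveOfFinrankEq φ hinj Subspace.dual_finrank_eq.symm
  let T : Module.End k V := e.symm.toLinearMap ∘ₗ ψ
  have hTφ : ∀ x y, φ (T x) y = ψ x y := fun x y =>
    LinearMap.congr_fun (e.apply_symm_apply (ψ x)) y
  have hT : ∀ x y, φ (T x) y = φ x (T y) := by
    intro x y
    rw [hφ.apply_swap x, hTφ, hTφ, hψ.apply_swap]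
  have hψT : ∀ x y, ψ x y = φ x (T y) := fun x y => by rw [← hTφ, hT]
  obtain ⟨a, c, ha, h0, h1⟩ := exists_irreducible_pow_annihilates hind hT hψT
  let ρ : AdjoinRoot (a ^ (c + 1)) →ₐ[k] Module.End k V :=
    Ideal.Quotient.liftₐ (Ideal.span {a ^ (c + 1)}) (aeval T) (by
      intro q hq
      obtain ⟨r, rfl⟩ := Ideal.mem_span_singleton.mp hq
      rw [map_mul, h0, zero_mul])
  have hρ : ∀ p, ρ (AdjoinRoot.mk _ p) = aeval T p := fun p => rfl
  have hadj : ∀ r x y, φ (ρ r x) y = φ x (ρ r y) := by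
    intro r x y
    obtain ⟨p, rfl⟩ := AdjoinRoot.mk_surjective r
    rw [hρ, aeval_selfAdjoint hT]
  have hiso : ∀ r t x, φ (ρ r x) (ρ t x) = 0 := by
    intro r t x
    rw [← hadj, ← Module.End.mul_apply, ← map_mul]
    obtain ⟨p, hp⟩ := AdjoinRoot.mk_surjective (t * r)
    rw [← hp, hρ]
    exact aeval_isotropic hφ hT (fun x => by rw [hTφ]; exact hψ x) p x
  obtain ⟨v, hv⟩ : ∃ v, aeval T (a ^ c) v ≠ 0 := by
    by_contra! hall
    exact h1 (LinearMap.ext hall)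
  obtain ⟨w, hw⟩ : ∃ w, φ (aeval T (a ^ c) v) w ≠ 0 := by
    by_contra! hall
    exact hv (hinj (by rw [map_zero]; exact LinearMap.ext hall))
  let l : AdjoinRoot (a ^ (c + 1)) →ₗ[k] k :=
    { toFun := fun r => φ (ρ r v) w
      map_add' := by simp
      map_smul' := by simp }
  have hl : ∀ r, φ (ρ r v) w = l r := fun r => rfl
  -- Every nonzero ideal contains $a^c$, and `l` is nonzero there by the choice of `v` and `w`.
  -- Hence `(t, r) ↦ l (t * r)` is nondegenerate, and so is `φ` on the range of `s`.
  have hnd : ∀ r, (∀ t, l (t * r) = 0) → r = 0 := by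
    intro r hr
    by_contra hne
    obtain ⟨t, ht⟩ := exists_mul_eq_mk_pow ha hne
    have := hr t
    rw [ht, ← hl, hρ] at this
    exact hw this
  let s : (AdjoinRoot (a ^ (c + 1)) × AdjoinRoot (a ^ (c + 1))) →ₗ[k] V :=
    ((LinearMap.applyₗ v) ∘ₗ ρ.toLinearMap).coprod ((LinearMap.applyₗ w) ∘ₗ ρ.toLinearMap)
  have hs : ∀ x, s x = ρ x.1 v + ρ x.2 w := fun x => rfl
  have hvw : ∀ r t, φ (ρ r v) (ρ t w) = l (r * t) := by
    intro r t
    rw [← hadj, ← Module.End.mul_apply, ← map_mul, mul_comm, hl]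
  have hφs : ∀ x y, φ (s x) (s y) = l (x.1 * y.2 - y.1 * x.2) := by
    intro x y
    simp only [hs, map_add, LinearMap.add_apply, hiso, hvw, hφ.apply_swap (ρ x.2 w), map_sub]
    ring
  have hsT : ∀ x, T (s x) = s (AdjoinRoot.root _ * x.1, AdjoinRoot.root _ * x.2) := by
    intro x
    have : ρ (AdjoinRoot.root _) = T := (hρ X).trans (aeval_X T)
    rw [hs, hs, map_mul, map_mul, this, map_add]
    rfl
  have hsnd : ∀ x, (∀ y, φ (s x) (s y) = 0) → x = 0 := by
    intro x hx
    refine Prod.ext (hnd _ fun t => ?_) (hnd _ fun t => ?_)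
    · simpa [hφs, mul_comm] using hx (0, t)
    · simpa [hφs] using hx (t, 0)
  have hinjs : Function.Injective s := by
    rw [injective_iff_map_eq_zero]
    exact fun x hx => hsnd x fun y => by rw [hx, map_zero, LinearMap.zero_apply]
  have hcompl : IsCompl (LinearMap.range s) (φ.orthogonal (LinearMap.range s)) := by
    rw [LinearMap.BilinForm.isCompl_orthogonal_iff_disjoint hφ.isRefl, Submodule.disjoint_def]
    rintro _ ⟨x, rfl⟩ hx
    rw [hsnd x, map_zero]
    intro y
    rw [hφ.apply_swap, hx _ ⟨y, rfl⟩, neg_zero]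
  have htop : LinearMap.range s = ⊤ := by
    have horth : ∀ x ∈ LinearMap.range s, ∀ y ∈ φ.orthogonal (LinearMap.range s),
        φ x y = 0 ∧ ψ x y = 0 := by
      rintro _ ⟨x, rfl⟩ y hy
      refine ⟨hy _ ⟨x, rfl⟩, ?_⟩
      rw [← hTφ, hsT]
      exact hy _ ⟨_, rfl⟩
    rcases hind _ _ hcompl horth with hr | hr
    · exfalso
      have : s (1, 0) ∈ LinearMap.range s := ⟨_, rfl⟩
      rw [hr, Submodule.mem_bot, hs, map_one, map_zero] at this
      simp only [Module.End.one_apply, LinearMap.zero_apply, add_zero] at this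
      rw [this, map_zero] at hv
      exact hv rfl
    · simpa [hr] using hcompl.sup_eq_top
  have hψs : ∀ x y, ψ (s x) (s y) = l (AdjoinRoot.root _ * (x.1 * y.2 - y.1 * x.2)) := by
    intro x y
    rw [← hTφ, hsT, hφs]
    congr 1
    ring
  exact ⟨a, c, ha, l, LinearEquiv.ofBijective s ⟨hinjs, LinearMap.range_eq_top.mp htop⟩,
    fun x y => ⟨hφs x y, hψs x y⟩⟩

end Sloped

/-! ### From bimaps to isoclinisms with the matrix groups. -/

section Groups

theorem commutation_mk {G : Type*} [Group G] (x y : G) :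
    (commutation G (QuotientGroup.mk x) (QuotientGroup.mk y) : G) = ⁅x, y⁆ := rfl

/-- A group whose commutation map is presented by a bimap is isoclinic to every group with the
same presentation. -/
theorem isoclinic_of_presentation {G H V W W₀ : Type*} [Group G] [Group H] [AddCommGroup V]
    [AddCommGroup W] [AddCommGroup W₀]
    (eV : Additive (G ⧸ Subgroup.center G) ≃+ V) (eW : Additive (commutator G) ≃+ W)
    (B : V → V → W)
    (hB : ∀ x y, eW (Additive.ofMul (commutation G x y)) =
      B (eV (Additive.ofMul x)) (eV (Additive.ofMul y)))
    (hnd : ∀ v, (∀ v', B v v' = 0) ↔ v = 0)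
    (π : H →* Multiplicative V) (hπ : Function.Surjective π)
    (ι : Multiplicative W₀ →* H) (q : W₀ →+ W) (hq : Function.Surjective q)
    (hι : ∀ w, ι (Multiplicative.ofAdd w) = 1 ↔ q w = 0)
    (β : H → H → W₀) (hβ : ∀ x y, ⁅x, y⁆ = ι (Multiplicative.ofAdd (β x y)))
    (hβB : ∀ x y, q (β x y) = B (π x).toAdd (π y).toAdd)
    (hβs : ∀ w, ∃ x y, β x y = w) : Isoclinic G H := by
  -- Nondegeneracy of `B` identifies the center of `H`, with no matrix computation.
  have hker : Subgroup.center H = π.ker := by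
    ext x
    rw [MonoidHom.mem_ker, ← toAdd_eq_zero, ← hnd, Subgroup.mem_center_iff]
    have h1 : ∀ y, y * x = x * y ↔ B (π x).toAdd (π y).toAdd = 0 := by
      intro y
      rw [← hβB, ← hι, ← hβ, commutatorElement_eq_one_iff_mul_comm, eq_comm]
    exact ⟨fun h v => by
      obtain ⟨y, hy⟩ := hπ (Multiplicative.ofAdd v)
      have := (h1 y).mp (h y)
      rwa [hy] at this, fun h y => (h1 y).mpr (h _)⟩
  -- Every `ι w` is a single commutator, so the image of `ι` is exactly $[H,H]$; as its kernel is
  -- that of `q`, this gives $W\cong[H,H]$.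
  have hmem : ∀ w, ι w ∈ commutator H := by
    intro w
    obtain ⟨x, y, hxy⟩ := hβs w.toAdd
    have := hβ x y
    rw [hxy, ofAdd_toAdd] at this
    rw [← this, commutator_def]
    exact Subgroup.commutator_mem_commutator (Subgroup.mem_top x) (Subgroup.mem_top y)
  let ι' : Multiplicative W₀ →* commutator H := ι.codRestrict _ hmem
  have hι' : Function.Surjective ι' := by
    have hle : commutator H ≤ ι.range := by
      rw [commutator_def, Subgroup.commutator_le]
      exact fun x _ y _ => ⟨_, (hβ x y).symm⟩
    rintro ⟨z, hz⟩
    obtain ⟨w, hw⟩ := hle hz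
    exact ⟨w, Subtype.ext hw⟩
  have hkerι : ι'.ker = (AddMonoidHom.toMultiplicative q).ker := by
    ext w
    rw [MonoidHom.mem_ker, MonoidHom.mem_ker, Subtype.ext_iff]
    exact hι w.toAdd
  let fH : H ⧸ Subgroup.center H ≃* Multiplicative V :=
    (QuotientGroup.quotientMulEquivOfEq hker).trans (QuotientGroup.quotientKerEquivOfSurjective π hπ)
  have hfH : ∀ x : H, fH (QuotientGroup.mk x) = π x := fun x => rfl
  let e1 := QuotientGroup.quotientKerEquivOfSurjective ι' hι'
  have hqm : Function.Surjective (AddMonoidHom.toMultiplicative q) := hq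
  let e2 := QuotientGroup.quotientKerEquivOfSurjective (AddMonoidHom.toMultiplicative q) hqm
  let fW : Multiplicative W ≃* commutator H :=
    (e2.symm.trans (QuotientGroup.quotientMulEquivOfEq hkerι.symm)).trans e1
  have hfW : ∀ w, fW (Multiplicative.ofAdd (q w)) = ι' (Multiplicative.ofAdd w) := by
    intro w
    have : e2.symm (Multiplicative.ofAdd (q w)) = QuotientGroup.mk (Multiplicative.ofAdd w) := by
      rw [MulEquiv.symm_apply_eq]
      rfl
    change e1 (QuotientGroup.quotientMulEquivOfEq hkerι.symm (e2.symm _)) = _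
    rw [this]
    rfl
  refine ⟨(AddEquiv.toMultiplicativeRight eV).trans fH.symm,
    (AddEquiv.toMultiplicativeRight eW).trans fW, fun x y => ?_⟩
  change commutation H (fH.symm (Multiplicative.ofAdd (eV (Additive.ofMul x))))
    (fH.symm (Multiplicative.ofAdd (eV (Additive.ofMul y)))) =
      fW (Multiplicative.ofAdd (eW (Additive.ofMul (commutation G x y))))
  rw [hB]
  obtain ⟨a, ha⟩ := hπ (Multiplicative.ofAdd (eV (Additive.ofMul x)))
  obtain ⟨b, hb⟩ := hπ (Multiplicative.ofAdd (eV (Additive.ofMul y)))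
  rw [← ha, ← hb, ← hfH, ← hfH, MulEquiv.symm_apply_apply, MulEquiv.symm_apply_apply]
  apply Subtype.ext
  rw [commutation_mk, hβ]
  have h2 := hβB a b
  rw [ha, hb] at h2
  simp only [toAdd_ofAdd] at h2
  rw [← h2, hfW]
  rfl

/-- The Heisenberg group element with given coordinates. -/
def heisenbergMk {R : Type*} [CommRing R] (e f w : R) : heisenberg R :=
  ⟨⟨heisenbergMatrix e f w, heisenbergMatrix (-e) (-f) (-w + e * f),
    by rw [heisenbergMatrix_mul, ← heisenbergMatrix_zero]; congr 1 <;> ring,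
    by rw [heisenbergMatrix_mul, ← heisenbergMatrix_zero]; congr 1 <;> ring⟩, e, f, w, rfl⟩

theorem heisenbergMatrix_inj {R : Type*} [CommRing R] {e f w e' f' w' : R} :
    heisenbergMatrix e f w = heisenbergMatrix e' f' w' ↔ e = e' ∧ f = f' ∧ w = w' := by
  refine ⟨fun h => ⟨?_, ?_, ?_⟩, by rintro ⟨rfl, rfl, rfl⟩; rfl⟩
  · exact congrFun (congrFun h 0) 1
  · exact congrFun (congrFun h 1) 2
  · exact congrFun (congrFun h 0) 2

theorem heisenberg_exists_mk {R : Type*} [CommRing R] (g : heisenberg R) :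
    ∃ e f w, g = heisenbergMk e f w := by
  obtain ⟨e, f, w, h⟩ := g.2
  exact ⟨e, f, w, Subtype.ext (Units.ext h)⟩

theorem heisenbergMk_mul {R : Type*} [CommRing R] (e f w e' f' w' : R) :
    heisenbergMk e f w * heisenbergMk e' f' w' =
      heisenbergMk (e + e') (f + f') (w + w' + e * f') :=
  Subtype.ext (Units.ext (heisenbergMatrix_mul e f w e' f' w'))

theorem heisenbergMk_commutator {R : Type*} [CommRing R] (e f w e' f' w' : R) :
    ⁅heisenbergMk e f w, heisenbergMk e' f' w'⁆ = heisenbergMk 0 0 (e * f' - e' * f) := by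
  rw [commutatorElement_def, mul_inv_eq_iff_eq_mul, mul_inv_eq_iff_eq_mul]
  simp only [heisenbergMk_mul]
  congr 1 <;> ring

theorem heisenbergMk_mem_central {R : Type*} [CommRing R] {L : AddSubgroup R} {e f w : R} :
    heisenbergMk e f w ∈ heisenbergCentral L ↔ e = 0 ∧ f = 0 ∧ w ∈ L := by
  constructor
  · rintro ⟨w', hw', h⟩
    obtain ⟨rfl, rfl, rfl⟩ := heisenbergMatrix_inj.mp h
    exact ⟨rfl, rfl, hw'⟩
  · rintro ⟨rfl, rfl, hw⟩
    exact ⟨w, hw, rfl⟩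

theorem heisenbergCentral_le_commutator {R : Type*} [CommRing R] (L : AddSubgroup R) :
    heisenbergCentral L ≤ commutator (heisenberg R) := by
  intro g hg
  obtain ⟨e, f, w, rfl⟩ := heisenberg_exists_mk g
  obtain ⟨rfl, rfl, -⟩ := heisenbergMk_mem_central.mp hg
  have h := heisenbergMk_commutator 1 0 0 0 w 0
  rw [one_mul, zero_mul, sub_zero] at h
  rw [← h, commutator_def]
  exact Subgroup.commutator_mem_commutator (Subgroup.mem_top _) (Subgroup.mem_top _)

/-- Commutators in the Heisenberg group are $ef'-e'f$; dividing by the kernel of `q` makes this the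
bimap $q(ef'-e'f)$. -/
theorem isoclinic_heisenberg_quotient {G V W R : Type*} [Group G] [AddCommGroup V]
    [AddCommGroup W] [CommRing R]
    (eV : Additive (G ⧸ Subgroup.center G) ≃+ V) (eW : Additive (commutator G) ≃+ W)
    (B : V → V → W)
    (hB : ∀ x y, eW (Additive.ofMul (commutation G x y)) =
      B (eV (Additive.ofMul x)) (eV (Additive.ofMul y)))
    (hnd : ∀ v, (∀ v', B v v' = 0) ↔ v = 0) (s : R × R ≃+ V) (q : R →+ W)
    (hq : Function.Surjective q) (hqB : ∀ x y, B (s x) (s y) = q (x.1 * y.2 - y.1 * x.2)) :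
    Isoclinic G (heisenberg R ⧸ heisenbergCentral q.ker) := by
  let π₀ : heisenberg R →* Multiplicative V := MonoidHom.mk'
    (fun g => Multiplicative.ofAdd (s (g.1.1 0 1, g.1.1 1 2))) (by
      intro g h
      obtain ⟨e, f, w, rfl⟩ := heisenberg_exists_mk g
      obtain ⟨e', f', w', rfl⟩ := heisenberg_exists_mk h
      rw [heisenbergMk_mul, ← ofAdd_add, ← map_add]
      rfl)
  have hπ₀ : ∀ e f w, π₀ (heisenbergMk e f w) = Multiplicative.ofAdd (s (e, f)) := fun _ _ _ => rfl
  let π : heisenberg R ⧸ heisenbergCentral q.ker →* Multiplicative V :=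
    QuotientGroup.lift _ π₀ (by
      intro g hg
      obtain ⟨e, f, w, rfl⟩ := heisenberg_exists_mk g
      obtain ⟨rfl, rfl, -⟩ := heisenbergMk_mem_central.mp hg
      rw [MonoidHom.mem_ker, hπ₀, ← Prod.zero_eq_mk, map_zero, ofAdd_zero])
  let ι₀ : Multiplicative R →* heisenberg R := MonoidHom.mk'
    (fun w => heisenbergMk 0 0 w.toAdd) (by
      intro x y
      rw [heisenbergMk_mul, toAdd_mul]
      simp)
  have hmk : ∀ x : heisenberg R ⧸ heisenbergCentral q.ker,
      ∃ e f w, x = QuotientGroup.mk (heisenbergMk e f w) := by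
    intro x
    obtain ⟨g, rfl⟩ := QuotientGroup.mk_surjective x
    obtain ⟨e, f, w, rfl⟩ := heisenberg_exists_mk g
    exact ⟨e, f, w, rfl⟩
  have hπ : ∀ e f w, π (QuotientGroup.mk (heisenbergMk e f w)) = Multiplicative.ofAdd (s (e, f)) :=
    fun _ _ _ => rfl
  let c : heisenberg R ⧸ heisenbergCentral q.ker → R × R := fun x => s.symm (π x).toAdd
  have hc : ∀ e f w, c (QuotientGroup.mk (heisenbergMk e f w)) = (e, f) :=
    fun e f w => s.symm_apply_apply (e, f)
  refine isoclinic_of_presentation eV eW B hB hnd π ?_ ((QuotientGroup.mk' _).comp ι₀) q hq ?_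
    (fun x y => (c x).1 * (c y).2 - (c y).1 * (c x).2) ?_ ?_ ?_
  · intro v
    refine ⟨QuotientGroup.mk (heisenbergMk (s.symm v.toAdd).1 (s.symm v.toAdd).2 0), ?_⟩
    rw [hπ, Prod.mk.eta, s.apply_symm_apply, ofAdd_toAdd]
  · intro w
    rw [MonoidHom.comp_apply, QuotientGroup.mk'_apply, QuotientGroup.eq_one_iff]
    exact heisenbergMk_mem_central.trans (by simp [AddMonoidHom.mem_ker])
  · intro x y
    obtain ⟨e, f, w, rfl⟩ := hmk x
    obtain ⟨e', f', w', rfl⟩ := hmk y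
    rw [hc, hc]
    exact congrArg QuotientGroup.mk (heisenbergMk_commutator e f w e' f' w')
  · intro x y
    obtain ⟨e, f, w, rfl⟩ := hmk x
    obtain ⟨e', f', w', rfl⟩ := hmk y
    rw [hc, hc, hπ, hπ, toAdd_ofAdd, toAdd_ofAdd, hqB]
  · intro w
    refine ⟨QuotientGroup.mk (heisenbergMk 1 0 0), QuotientGroup.mk (heisenbergMk 0 w 0), ?_⟩
    rw [hc, hc]
    simp

/-- The element of the flat group with given coordinates. -/
def flatMk {k : Type*} [Field k] {m : ℕ} (e : Fin m → k) (f : Fin (m + 1) → k)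
    (w : Fin 2 → k) : flatGroup k m :=
  ⟨⟨flatMatrix e f w, flatMatrix (-e) (-f) (-w + (flatBlock e).mulVec f),
    by
      rw [flatMatrix_mul, ← flatMatrix_zero, Matrix.mulVec_neg]
      congr 1 <;> abel,
    by
      have h : flatBlock (-e) = -flatBlock e := by
        rw [eq_neg_iff_add_eq_zero, ← flatBlock_add, neg_add_cancel, flatBlock_zero]
      rw [flatMatrix_mul, ← flatMatrix_zero, h, Matrix.neg_mulVec]
      congr 1 <;> abel⟩, e, f, w, rfl⟩

theorem flatMatrix_inj {k : Type*} [Field k] {m : ℕ} {e e' : Fin m → k} {f f' : Fin (m + 1) → k}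
    {w w' : Fin 2 → k} : flatMatrix e f w = flatMatrix e' f' w' ↔ e = e' ∧ f = f' ∧ w = w' := by
  refine ⟨fun h => ⟨funext fun i => ?_, funext fun i => ?_, funext fun i => ?_⟩,
    by rintro ⟨rfl, rfl, rfl⟩; rfl⟩
  · simpa [flatMatrix, flatBlock] using
      congrFun (congrFun h (Sum.inl 0)) (Sum.inr (Sum.inl i.castSucc))
  · exact congrFun (congrFun h (Sum.inr (Sum.inl i))) (Sum.inr (Sum.inr ()))
  · exact congrFun (congrFun h (Sum.inl i)) (Sum.inr (Sum.inr ()))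

theorem flatGroup_exists_mk {k : Type*} [Field k] {m : ℕ} (g : flatGroup k m) :
    ∃ e f w, g = flatMk e f w := by
  obtain ⟨e, f, w, h⟩ := g.2
  exact ⟨e, f, w, Subtype.ext (Units.ext h)⟩

theorem flatMk_inj {k : Type*} [Field k] {m : ℕ} {e e' : Fin m → k} {f f' : Fin (m + 1) → k}
    {w w' : Fin 2 → k} : flatMk e f w = flatMk e' f' w' ↔ e = e' ∧ f = f' ∧ w = w' :=
  ⟨fun h => flatMatrix_inj.mp (congrArg (fun g : flatGroup k m => g.1.1) h),
    by rintro ⟨rfl, rfl, rfl⟩; rfl⟩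

theorem flatMk_mul {k : Type*} [Field k] {m : ℕ} (e e' : Fin m → k) (f f' : Fin (m + 1) → k)
    (w w' : Fin 2 → k) : flatMk e f w * flatMk e' f' w' =
      flatMk (e + e') (f + f') (w + w' + (flatBlock e).mulVec f') :=
  Subtype.ext (Units.ext (flatMatrix_mul e e' f f' w w'))

theorem flatMk_commutator {k : Type*} [Field k] {m : ℕ} (e e' : Fin m → k)
    (f f' : Fin (m + 1) → k) (w w' : Fin 2 → k) : ⁅flatMk e f w, flatMk e' f' w'⁆ =
      flatMk 0 0 ((flatBlock e).mulVec f' - (flatBlock e').mulVec f) := by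
  rw [commutatorElement_def, mul_inv_eq_iff_eq_mul, mul_inv_eq_iff_eq_mul]
  simp only [flatMk_mul, flatBlock_zero, Matrix.zero_mulVec, zero_add, flatMk_inj]
  refine ⟨add_comm _ _, add_comm _ _, by abel⟩

theorem isoclinic_flatGroup {G V W k : Type*} [Group G] [AddCommGroup V]
    [AddCommGroup W] [Field k] {m : ℕ}
    (eV : Additive (G ⧸ Subgroup.center G) ≃+ V) (eW : Additive (commutator G) ≃+ W)
    (B : V → V → W)
    (hB : ∀ x y, eW (Additive.ofMul (commutation G x y)) =
      B (eV (Additive.ofMul x)) (eV (Additive.ofMul y)))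
    (hnd : ∀ v, (∀ v', B v v' = 0) ↔ v = 0)
    (s : (Fin (m + 1) → k) × (Fin (m + 2) → k) ≃+ V) (q : (Fin 2 → k) ≃+ W)
    (hqB : ∀ x y, B (s x) (s y) =
      q ((flatBlock x.1).mulVec y.2 - (flatBlock y.1).mulVec x.2)) :
    Isoclinic G (flatGroup k (m + 1)) := by
  choose E F C hEFC using flatGroup_exists_mk (k := k) (m := m + 1)
  have hE : ∀ e f w, E (flatMk e f w) = e := fun e f w => (flatMk_inj.mp (hEFC (flatMk e f w))).1.symm
  have hF : ∀ e f w, F (flatMk e f w) = f :=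
    fun e f w => (flatMk_inj.mp (hEFC (flatMk e f w))).2.1.symm
  let π : flatGroup k (m + 1) →* Multiplicative V := MonoidHom.mk'
    (fun g => Multiplicative.ofAdd (s (E g, F g))) (by
      intro g h
      obtain ⟨e, f, w, rfl⟩ := flatGroup_exists_mk g
      obtain ⟨e', f', w', rfl⟩ := flatGroup_exists_mk h
      rw [flatMk_mul, ← ofAdd_add, ← map_add]
      simp only [hE, hF, Prod.mk_add_mk])
  have hπ : ∀ g, π g = Multiplicative.ofAdd (s (E g, F g)) := fun _ => rfl
  let ι : Multiplicative (Fin 2 → k) →* flatGroup k (m + 1) := MonoidHom.mk'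
    (fun w => flatMk 0 0 w.toAdd) (by
      intro x y
      rw [flatMk_mul, toAdd_mul]
      simp)
  refine isoclinic_of_presentation eV eW B hB hnd π ?_ ι q.toAddMonoidHom q.surjective ?_
    (fun x y => (flatBlock (E x)).mulVec (F y) - (flatBlock (E y)).mulVec (F x)) ?_ ?_ ?_
  · intro v
    refine ⟨flatMk (s.symm v.toAdd).1 (s.symm v.toAdd).2 0, ?_⟩
    rw [hπ, hE, hF, Prod.mk.eta, s.apply_symm_apply, ofAdd_toAdd]
  · intro w
    have h1 : (1 : flatGroup k (m + 1)) = flatMk 0 0 0 :=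
      Subtype.ext (Units.ext flatMatrix_zero.symm)
    rw [h1]
    refine flatMk_inj.trans ?_
    simp
  · intro x y
    rw [hEFC x, hEFC y]
    simp only [hE, hF]
    exact flatMk_commutator _ _ _ _ _ _
  · intro x y
    rw [hπ, hπ, toAdd_ofAdd, toAdd_ofAdd, hqB]
    rfl
  · intro w
    -- For the first basis vector `e`, the block sends `f` to its first two entries, so these can be
    -- prescribed as `w`.
    refine ⟨flatMk (Pi.single 0 1) 0 0, flatMk 0 (Fin.cons (w 0) (Fin.cons (w 1) 0)) 0, ?_⟩
    simp only [hE, hF, flatBlock_zero, Matrix.zero_mulVec, sub_zero]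
    have h1 : ∀ f : Fin (m + 2) → k, (flatBlock (Pi.single 0 1)).mulVec f = ![f 0, f 1] := by
      intro f
      funext l
      fin_cases l
      · simp [flatBlock, dotProduct, Fin.sum_univ_castSucc (n := m + 1), Pi.single_apply]
      · simp [flatBlock, dotProduct, Fin.sum_univ_succ (n := m + 1), Pi.single_apply]
    rw [h1]
    funext l
    fin_cases l <;> rfl

end Groups

/-! ### Translating properties of $G$ into properties of its bimap. -/

section Main

variable {k : Type*} [Field k] {G : Type*} [Group G] {V W : Type*} [AddCommGroup V] [Module k V]
  [AddCommGroup W] [Module k W]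
  {eV : Additive (G ⧸ Subgroup.center G) ≃+ V} {eW : Additive (commutator G) ≃+ W}
  {B : V →ₗ[k] V →ₗ[k] W}

/-- The quotient map to `G/Z(G)`, in additive coordinates. -/
def centralCoordinate (eV : Additive (G ⧸ Subgroup.center G) ≃+ V) : G →* Multiplicative V :=
  (AddEquiv.toMultiplicativeRight eV).toMonoidHom.comp (QuotientGroup.mk' _)

theorem centralCoordinate_surjective (eV : Additive (G ⧸ Subgroup.center G) ≃+ V) :
    Function.Surjective (centralCoordinate eV) :=
  (AddEquiv.toMultiplicativeRight eV).surjective.comp (QuotientGroup.mk'_surjective _)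

theorem bimap_centralCoordinate_eq_zero_iff
    (hB : ∀ x y, eW (Additive.ofMul (commutation G x y)) =
      B (eV (Additive.ofMul x)) (eV (Additive.ofMul y))) (g h : G) :
    B (centralCoordinate eV g).toAdd (centralCoordinate eV h).toAdd = 0 ↔ ⁅g, h⁆ = 1 := by
  have := hB (QuotientGroup.mk g) (QuotientGroup.mk h)
  change B (eV (Additive.ofMul (QuotientGroup.mk g))) (eV (Additive.ofMul (QuotientGroup.mk h))) = 0
    ↔ _
  rw [← this, EmbeddingLike.map_eq_zero_iff, ofMul_eq_zero, Subtype.ext_iff, commutation_mk]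
  rfl

theorem bimap_self
    (hB : ∀ x y, eW (Additive.ofMul (commutation G x y)) =
      B (eV (Additive.ofMul x)) (eV (Additive.ofMul y))) (v : V) : B v v = 0 := by
  obtain ⟨g, hg⟩ := centralCoordinate_surjective eV (Multiplicative.ofAdd v)
  have := (bimap_centralCoordinate_eq_zero_iff hB g g).mpr (commutatorElement_self g)
  rwa [hg] at this

theorem bimap_nondegenerate
    (hB : ∀ x y, eW (Additive.ofMul (commutation G x y)) =
      B (eV (Additive.ofMul x)) (eV (Additive.ofMul y))) (v : V) :
    (∀ v', B v v' = 0) ↔ v = 0 := by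
  refine ⟨fun h => ?_, by rintro rfl; simp⟩
  obtain ⟨g, hg⟩ := centralCoordinate_surjective eV (Multiplicative.ofAdd v)
  have hz : g ∈ Subgroup.center G := by
    rw [Subgroup.mem_center_iff]
    intro x
    have := (bimap_centralCoordinate_eq_zero_iff hB g x).mp (by rw [hg]; exact h _)
    exact (commutatorElement_eq_one_iff_mul_comm.mp this).symm
  have h1 : (QuotientGroup.mk g : G ⧸ Subgroup.center G) = 1 := (QuotientGroup.eq_one_iff g).mpr hz
  have h2 : eV (Additive.ofMul (QuotientGroup.mk g)) = v := hg
  rw [← h2, h1, ofMul_one, map_zero]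

/-- The elements of $[G,G]$ with coordinates in `S` form a subgroup containing every commutator. -/
theorem bimap_span
    (hB : ∀ x y, eW (Additive.ofMul (commutation G x y)) =
      B (eV (Additive.ofMul x)) (eV (Additive.ofMul y))) {S : Submodule k W}
    (hS : ∀ x y, B x y ∈ S) : S = ⊤ := by
  let T : Subgroup G :=
    (S.toAddSubgroup.toSubgroup.comap (AddEquiv.toMultiplicativeRight eW).toMonoidHom).map
      (commutator G).subtype
  have hT : commutator G ≤ T := by
    conv_lhs => rw [commutator_def]
    rw [Subgroup.commutator_le]
    intro g _ h _
    refine ⟨commutation G (QuotientGroup.mk g) (QuotientGroup.mk h), ?_, commutation_mk g h⟩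
    change eW (Additive.ofMul (commutation G _ _)) ∈ S
    rw [hB]
    exact hS _ _
  rw [eq_top_iff]
  intro w _
  obtain ⟨z, hz, hzw⟩ := hT (Additive.toMul (eW.symm w)).2
  have h1 : z = Additive.toMul (eW.symm w) := Subtype.ext hzw
  have h2 : eW (Additive.ofMul z) ∈ S := hz
  rwa [h1, ofMul_toMul, eW.apply_symm_apply] at h2

/-- The preimages of `P` and `Q` in $G$ generate $G$ and commute; if both summands were nonzero,
both preimages would be proper, giving a central decomposition other than $\{G\}$. -/
theorem bimap_indecomposable (hG : IsCentrallyIndecomposable G)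
    (hB : ∀ x y, eW (Additive.ofMul (commutation G x y)) =
      B (eV (Additive.ofMul x)) (eV (Additive.ofMul y))) {P Q : Submodule k V}
    (hPQ : IsCompl P Q) (horth : ∀ x ∈ P, ∀ y ∈ Q, B x y = 0) : P = ⊥ ∨ Q = ⊥ := by
  let pre : Submodule k V → Subgroup G := fun P =>
    P.toAddSubgroup.toSubgroup.comap (centralCoordinate eV)
  have hpre : ∀ P g, g ∈ pre P ↔ (centralCoordinate eV g).toAdd ∈ P := fun _ _ => Iff.rfl
  have htop : ∀ P, pre P = ⊤ → P = ⊤ := by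
    intro P hP
    rw [eq_top_iff]
    intro v _
    obtain ⟨g, hg⟩ := centralCoordinate_surjective eV (Multiplicative.ofAdd v)
    have := (hpre P g).mp (hP ▸ Subgroup.mem_top g)
    rwa [hg] at this
  have hsup : pre P ⊔ pre Q = ⊤ := by
    rw [eq_top_iff]
    intro g _
    obtain ⟨a, ha, b, hb, hab⟩ := Submodule.mem_sup.mp
      (hPQ.sup_eq_top ▸ Submodule.mem_top : (centralCoordinate eV g).toAdd ∈ P ⊔ Q)
    obtain ⟨x, hx⟩ := centralCoordinate_surjective eV (Multiplicative.ofAdd a)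
    have h1 : x ∈ pre P := by rw [hpre, hx]; exact ha
    have h2 : x⁻¹ * g ∈ pre Q := by
      rw [hpre, map_mul, map_inv, hx, toAdd_mul, toAdd_inv, ← hab]
      simpa using hb
    have := Subgroup.mul_mem_sup h1 h2
    rwa [mul_inv_cancel_left] at this
  have hcomm : ⁅pre P, pre Q⁆ = ⊥ := by
    rw [eq_bot_iff, Subgroup.commutator_le]
    intro g hg h hh
    rw [Subgroup.mem_bot, ← bimap_centralCoordinate_eq_zero_iff hB]
    exact horth _ hg _ hh
  by_contra! hne
  have hP : pre P ≠ ⊤ := fun h => hne.2 (by simpa [htop P h] using hPQ.inf_eq_bot)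
  have hQ : pre Q ≠ ⊤ := fun h => hne.1 (by simpa [htop Q h] using hPQ.inf_eq_bot)
  have hPQne : pre P ≠ pre Q := by
    intro h
    rw [← h, sup_idem] at hsup
    exact hP hsup
  have hdec : IsCentralDecomposition {pre P, pre Q} := by
    refine ⟨by rwa [sSup_pair], ?_⟩
    rintro H (rfl | rfl)
    · rw [Set.pair_sdiff_left hPQne, sSup_singleton]
      exact ⟨hQ, hcomm⟩
    · rw [Set.pair_sdiff_right hPQne, sSup_singleton]
      exact ⟨hP, by rwa [Subgroup.commutator_comm]⟩
  have hmem : pre P ∈ ({⊤} : Set (Subgroup G)) := (hG _).mp hdec ▸ Set.mem_insert _ _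
  exact hP hmem

theorem isoclinic_heisenberg_of_injective {B : V →ₗ[k] V →ₗ[k] (Fin 2 → k)}
    {eW : Additive (commutator G) ≃+ (Fin 2 → k)} [FiniteDimensional k V] [Nontrivial V]
    (hB : ∀ x y, eW (Additive.ofMul (commutation G x y)) =
      B (eV (Additive.ofMul x)) (eV (Additive.ofMul y)))
    {i j : Fin 2} (hij : i ≠ j) {φ ψ : LinearMap.BilinForm k V}
    (hBφ : ∀ x y, B x y i = φ x y) (hBψ : ∀ x y, B x y j = ψ x y)
    (hφ : φ.IsAlt) (hψ : ψ.IsAlt) (hind : OrthogonallyIndecomposable φ ψ)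
    (hinj : Function.Injective φ) :
    ∃ (a : k[X]) (c : ℕ) (L : Submodule k (AdjoinRoot (a ^ c))),
      Irreducible a ∧ 0 < c ∧
      Module.finrank k (AdjoinRoot (a ^ c)) = c * a.natDegree ∧
      Module.finrank k (AdjoinRoot (a ^ c) ⧸ L) = 2 ∧
      heisenbergCentral L.toAddSubgroup ≤ commutator (heisenberg (AdjoinRoot (a ^ c))) ∧
      Isoclinic G (heisenberg (AdjoinRoot (a ^ c)) ⧸ heisenbergCentral L.toAddSubgroup) := by
  obtain ⟨a, c, ha, l, s, hs⟩ := exists_sloped_equiv hφ hψ hind hinj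
  -- The two forms are `l` and `l` after multiplication by the root, applied to the same commutator
  -- expression. So `L` is the kernel of `q`, and it has codimension 2 because commutators generate
  -- $[G,G]$.
  let q : AdjoinRoot (a ^ (c + 1)) →ₗ[k] (Fin 2 → k) := LinearMap.pi fun t =>
    if t = i then l else l ∘ₗ LinearMap.mulLeft k (AdjoinRoot.root _)
  have hq : ∀ x y, B (s x) (s y) = q (x.1 * y.2 - y.1 * x.2) := by
    intro x y
    funext t
    by_cases ht : t = i
    · subst ht
      rw [hBφ, (hs x y).1]
      simp [q]
    · obtain rfl : t = j := by omega
      rw [hBψ, (hs x y).2]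
      simp [q, ht]
  have hsurj : Function.Surjective q := by
    rw [← LinearMap.range_eq_top]
    refine bimap_span hB fun x y =>
      ⟨_, ((hq (s.symm x) (s.symm y)).symm.trans ?_)⟩
    rw [s.apply_symm_apply, s.apply_symm_apply]
  refine ⟨a, c + 1, LinearMap.ker q, ha, c.succ_pos, ?_, ?_, heisenbergCentral_le_commutator _, ?_⟩
  · have hne : a ^ (c + 1) ≠ 0 := pow_ne_zero _ ha.ne_zero
    rw [(AdjoinRoot.powerBasis hne).finrank, AdjoinRoot.powerBasis_dim, natDegree_pow]
  · rw [(q.quotKerEquivOfSurjective hsurj).finrank_eq, Module.finrank_fin_fun]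
  · exact isoclinic_heisenberg_quotient eV eW (fun x y => B x y) hB (bimap_nondegenerate hB)
      s.toAddEquiv q.toAddMonoidHom hsurj hq

end Main

theorem theorem1p2 (p : ℕ) [Fact p.Prime] (k : Type*) [Field k] (G : Type*) [Group G]
    (hp : IsPGroup p G) (hG : IsCentrallyIndecomposable G) (hk : HasGenusTwoOver k G) :
    (∃ (a : k[X]) (c : ℕ) (L : Submodule k (AdjoinRoot (a ^ c))),
      Irreducible a ∧ 0 < c ∧
      Module.finrank k (AdjoinRoot (a ^ c)) = c * a.natDegree ∧
      Module.finrank k (AdjoinRoot (a ^ c) ⧸ L) = 2 ∧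
      heisenbergCentral L.toAddSubgroup ≤ commutator (heisenberg (AdjoinRoot (a ^ c))) ∧
      Isoclinic G (heisenberg (AdjoinRoot (a ^ c)) ⧸ heisenbergCentral L.toAddSubgroup)) ∨
    (∃ m : ℕ, 0 < m ∧ Isoclinic G (flatGroup k m)) := by
  obtain ⟨d, eV, eW, B, hB⟩ := hk
  let form : Fin 2 → LinearMap.BilinForm k (Fin d → k) := fun i => B.compr₂ (LinearMap.proj i)
  have hform : ∀ i x y, B x y i = form i x y := fun _ _ _ => rfl
  have halt : ∀ i, (form i).IsAlt := fun i v => congrFun (bimap_self hB v) i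
  have hzero : ∀ {i j}, i ≠ j → ∀ x y, form i x y = 0 ∧ form j x y = 0 → B x y = 0 := by
    intro i j hij x y h
    funext t
    obtain rfl | rfl : t = i ∨ t = j := by omega
    · exact h.1
    · exact h.2
  have hind : ∀ {i j}, i ≠ j → OrthogonallyIndecomposable (form i) (form j) :=
    fun hij P Q hPQ horth => bimap_indecomposable hG hB hPQ fun x hx y hy =>
      hzero hij x y (horth x hx y hy)
  have h01 : (0 : Fin 2) ≠ 1 := by decide
  -- If $V=0$, all commutators would be trivial, whereas $[G,G]$ has dimension 2.
  have hV : Nontrivial (Fin d → k) := by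
    by_contra hsub
    rw [not_nontrivial_iff_subsingleton] at hsub
    have := bimap_span hB (S := ⊥) fun x y => by
      rw [Subsingleton.elim x 0]
      simp
    exact bot_ne_top this
  by_cases hreg : ∀ n γ, IsPencilChain (form 1) (form 0) n γ → γ = 0
  · left
    rcases injective_or_injective_of_regular (halt 1) (halt 0) (hind h01.symm) hreg with h | h
    · exact isoclinic_heisenberg_of_injective hB h01.symm (hform 1) (hform 0) (halt 1) (halt 0)
        (hind h01.symm) h
    · exact isoclinic_heisenberg_of_injective hB h01 (hform 0) (hform 1) (halt 0) (halt 1)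
        (hind h01) h
  · right
    have hnd : ∀ x, form 1 x = 0 → form 0 x = 0 → x = 0 := fun x h1 h0 =>
      (bimap_nondegenerate hB x).mp fun y => hzero h01 x y
        ⟨LinearMap.congr_fun h0 y, LinearMap.congr_fun h1 y⟩
    -- Taking `form 1` as `φ` puts the coordinates in the order of the flat matrix rows; negation on
    -- $k^2$ absorbs the remaining sign.
    obtain ⟨n, s, hs⟩ := exists_flat_equiv (halt 1) (halt 0) (hind h01.symm) hnd hreg
    refine ⟨n + 1, n.succ_pos, isoclinic_flatGroup eV eW (fun x y => B x y) hB
      (bimap_nondegenerate hB) s.toAddEquiv (AddEquiv.neg _) fun x y => ?_⟩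
    rw [← hs, AddEquiv.neg_apply]
    funext t
    fin_cases t
    · exact (neg_neg _).symm
    · exact (neg_neg _).symm
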